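/- Let $N_r\ge 1$, $M\ge 2$ and $n$ be integers with $M<2^n$. For $L\ge1$ let $\mathcal S_L=\{e^{j(\pi/4+2\pi i/L)}:i=0,\dots,L-1\}$ be the $L$-PSK constellation, and call a measurable map $Q:\mathbb C\to\mathcal S_L$ with $Q(x)\in\arg\min_{s\in\mathcal S_L}|s-x|$ for all $x$ a phase quantizer onto $\mathcal S_L$ (ties are broken arbitrarily). Let $\mathscr Q_n$ be a phase quantizer onto $\mathcal S_{2^n}$ (the $n$-bit receiver quantization) and $\mathscr Q'$ a phase quantizer onto $\mathcal S_M$ (the detector). Let $\mathbf K\in\mathbb C^{N_r\times N_r}$ be a full-rank (i.e. Hermitian positive definite) covariance matrix, and let $s$ be uniform on $\mathcal S_M$, $\mathbf h\sim\mathcal{CN}(\mathbf 0,\mathbf K)$ and $\mathbf n\sim\mathcal{CN}(\mathbf 0,\mathbf I)$ be mutually independent. For $\rho>0$ put $\mathbf y=\sqrt\rho\,\mathbf h s+\mathbf n$, $\mathbf r=\mathscr Q_n(\mathbf y)$ (entrywise), $\mathbf C=\rho\mathbf K+\mathbf I$, $\mathbf g=\mathbf C^{1/2}\mathbf K^{-1/2}\mathbf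 h$ (the AMRC combiner), $\widehat s=\mathscr Q'(\mathbf g^{\mathrm H}\mathbf r)$, and let $\mathscr P(\rho)=\Pr(\widehat s\ne s)$ be the average symbol error probability. Say that $\mathscr P$ has diversity gain $G_d>0$ and coding gain $G_c>0$ if $\mathscr P(\rho)=(G_c\rho)^{-G_d}+o(\rho^{-G_d})$ as $\rho\to\infty$. Then there is a constant $k\in[1,2]$, depending only on $N_r,M,n$, such that for every such $\mathbf K$ (and all such quantizers) $\mathscr P$ has diversity gain $$G_d=N_r$$ and coding gain $$G_c=\left(\frac{2^{nN_r-1}\,k\,N_r^{N_r}}{\pi^{N_r+\frac12}\,(2N_r)!\,\det(\mathbf K)}\left(\cot\Big(\frac\pi M-\frac\pi{2^n}\Big)-\cot\Big(\frac\pi M+\frac\pi{2^n}\Big)\right)^{N_r}\Gamma\Big(N_r+\tfrac12\Big)\right)^{-\frac1{N_r}}.$$ -/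

import Mathlib

open Filter Topology MeasureTheory ProbabilityTheory Asymptotics
open scoped Matrix ComplexOrder MatrixOrder Nat

noncomputable section

/-- The `L`-ary phase-shift keying constellation
`S_L = {exp (j (π/4 + (2π/L) i)) : i = 0, …, L - 1}`. -/
def pskConstellation (L : ℕ) : Set ℂ :=
  {s | ∃ i : ℕ, i < L ∧
    s = Complex.exp (((Real.pi / 4 + 2 * Real.pi / L * i : ℝ) : ℂ) * Complex.I)}

/-- `Q` is a phase quantizer (minimum-distance detector) with values in `S_L`: it maps every
complex number to a nearest point of `S_L`. How ties are broken is left open, as long as `Q` is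
measurable. The `n`-bit phase quantizers are those with `L = 2 ^ n`. -/
structure IsPhaseQuantizer (L : ℕ) (Q : ℂ → ℂ) : Prop where
  measurable : Measurable Q
  mem : ∀ x, Q x ∈ pskConstellation L
  isMin : ∀ x, ∀ s ∈ pskConstellation L, ‖Q x - x‖ ≤ ‖s - x‖

/-- The zero-mean circularly symmetric complex Gaussian distribution `CN(0, S)` on `ℂ^N` for a
(Hermitian) positive definite covariance matrix `S`: its density with respect to Lebesgue measure is
`z ↦ exp (- zᴴ S⁻¹ z) / (π ^ N det S)`. -/
def complexGaussian {N : ℕ} (S : Matrix (Fin N) (Fin N) ℂ) : Measure (Fin N → ℂ) :=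
  volume.withDensity fun z =>
    ENNReal.ofReal (Real.exp (-(star z ⬝ᵥ (S⁻¹ *ᵥ z)).re) / (Real.pi ^ N * S.det.re))

/-- The received signal `y = √ρ h s + n` prior to quantization. -/
def receivedSignal {N : ℕ} (ρ : ℝ) (s : ℂ) (h z : Fin N → ℂ) : Fin N → ℂ :=
  fun i => (Real.sqrt ρ : ℂ) * h i * s + z i

/-- The covariance matrix `C = ρ K + I` of the received signal prior to quantization. -/
def receivedCovariance {N : ℕ} (ρ : ℝ) (K : Matrix (Fin N) (Fin N) ℂ) :
    Matrix (Fin N) (Fin N) ℂ :=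
  (ρ : ℂ) • K + 1

/-- The asymptotic maximum ratio combiner `g = C^{1/2} K^{-1/2} h`; the square roots are the
positive semidefinite ones. -/
def amrcCombiner {N : ℕ} (ρ : ℝ) (K : Matrix (Fin N) (Fin N) ℂ) (h : Fin N → ℂ) : Fin N → ℂ :=
  (CFC.sqrt (receivedCovariance ρ K) * (CFC.sqrt K)⁻¹) *ᵥ h

/-- The estimated symbol `Q_det (gᴴ r)`, where `r = Q_adc (y)` (entrywise) is the quantized
received vector. -/
def amrcEstimate {N : ℕ} (Qadc Qdet : ℂ → ℂ) (ρ : ℝ) (K : Matrix (Fin N) (Fin N) ℂ)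
    (s : ℂ) (h z : Fin N → ℂ) : ℂ :=
  Qdet (star (amrcCombiner ρ K h) ⬝ᵥ fun i => Qadc (receivedSignal ρ s h z i))

/-- The average symbol error probability of the AMRC receiver at SNR `ρ`, for a random symbol `s`,
a random channel vector `h` and a random noise vector `z`. -/
def amrcSEP {Ω : Type*} [MeasurableSpace Ω] (P : Measure Ω) {N : ℕ} (Qadc Qdet : ℂ → ℂ)
    (K : Matrix (Fin N) (Fin N) ℂ) (s : Ω → ℂ) (h z : Ω → Fin N → ℂ) (ρ : ℝ) : ℝ :=
  P.real {ω | amrcEstimate Qadc Qdet ρ K (s ω) (h ω) (z ω) ≠ s ω}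

/-- An error probability `p`, as a function of the SNR `ρ`, has diversity gain `Gd` and coding gain
`Gc` if `p ρ = (Gc ρ) ^ (-Gd) + o(ρ ^ (-Gd))` as `ρ → ∞`, where `Gd, Gc > 0`. -/
def HasDiversityAndCodingGain (p : ℝ → ℝ) (Gd Gc : ℝ) : Prop :=
  0 < Gd ∧ 0 < Gc ∧ p ~[atTop] fun ρ => (Gc * ρ) ^ (-Gd)

/-- The closed-form coding gain with scaling factor `k`. -/
def codingGain (N M n : ℕ) (K : Matrix (Fin N) (Fin N) ℂ) (k : ℝ) : ℝ :=
  ((2 : ℝ) ^ ((n : ℝ) * N - 1) * k * (N : ℝ) ^ N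
      / (Real.pi ^ ((N : ℝ) + 1 / 2) * ((2 * N)! : ℝ) * K.det.re)
    * (Real.cot (Real.pi / M - Real.pi / 2 ^ n) - Real.cot (Real.pi / M + Real.pi / 2 ^ n)) ^ N
    * Real.Gamma ((N : ℝ) + 1 / 2)) ^ (-1 / (N : ℝ))

end

/-! The proof computes the limit of `ρ ^ N * SEP(ρ)` by changing variables from the channel to the
received signal. Fix the symbol `s` and the noise `z`, and replace `h` by `y = √ρ h s + z`. This map
scales `2N` real dimensions by `√ρ`, so the Jacobian is `ρ ^ N`: this is the diversity order. What
remains is the integral, over the error set in `(y, z)`, of the density of `h` at `conj s (y - z) /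
√ρ`, against Lebesgue measure in `y` times the Gaussian law of `z`.

As `ρ → ∞` the density tends to its value `1 / (π ^ N det K)` at the origin, and `C^{1/2} K^{-1/2} /
√ρ` tends to the identity. The derotated and conjugated decision variable therefore tends to `∑ conj
(Q y_i) (y_i - z_i)`, and in the limit an error means that this sum leaves the sector of half-angle
`π / M` (`tendsto_lintegral_symbolError`). Convergence is dominated: each `conj (Q y_i) y_i` lies in
the strictly smaller sector of half-angle `π / 2 ^ n`, so an error forces `∑ ‖y_i‖ ≤ C ∑ ‖z_i‖`
(`exists_eventually_derotatedStatistic_pos`), a set of finite measure (`measure_norm_le_lt_top`).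

The limiting error set is a union of two half-plane events, one per edge of the sector. For one edge
the measure `A` is explicit (`measure_edgeErrorSet`): the noise part is one real Gaussian `g` of
variance `N / 2` whatever `y` is; the signal part is a sum of `N` nonnegative terms, each
distributing Lebesgue measure as `κ x dx` (`lintegral_edgeNormal_quantizer`), so it is below `g > 0`
on a set of volume `κ ^ N g ^ (2N) / (2N)!` (`volume_sum_lt`); a Gaussian half-moment finishes.

Both edges give the same `A`, so the union has measure `k A` with `1 ≤ k ≤ 2`. The matrix `K` does
not enter the limiting set, and quantizers differ only on null sets, so `k` depends on `N`, `M`, `n`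
alone. For `M = 2` the two edges coincide. -/

open scoped ComplexConjugate ENNReal NNReal

/-! ### Sectors, PSK constellations and decision regions -/

/-- The inner normals (up to a quarter turn) of the two edges of the sector of half-angle `b`
around the positive real axis. -/
noncomputable def edgeNormal (b : ℝ) : Bool → ℂ
  | true => Complex.exp (b * Complex.I)
  | false => -Complex.exp (-(b * Complex.I))

theorem edgeNormal_true_eq (b : ℝ) : edgeNormal b true = ⟨Real.cos b, Real.sin b⟩ := by
  apply Complex.ext <;> simp [edgeNormal, Complex.exp_re, Complex.exp_im]

theorem edgeNormal_false_eq (b : ℝ) : edgeNormal b false = ⟨-Real.cos b, Real.sin b⟩ := by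
  apply Complex.ext <;> simp [edgeNormal, Complex.exp_re, Complex.exp_im]

theorem norm_edgeNormal (b : ℝ) (σ : Bool) : ‖edgeNormal b σ‖ = 1 := by
  cases σ
  · have : -((b : ℂ) * Complex.I) = ((-b : ℝ) : ℂ) * Complex.I := by push_cast; ring
    rw [edgeNormal, norm_neg, this, Complex.norm_exp_ofReal_mul_I]
  · rw [edgeNormal, Complex.norm_exp_ofReal_mul_I]

/-- Conjugation reflects the sector in the real axis and so swaps its edges. This is needed because
the detector sees `gᴴ r`, the conjugate of the natural statistic. -/
theorem im_edgeNormal_mul_conj (b : ℝ) (σ : Bool) (w : ℂ) :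
    (edgeNormal b σ * conj w).im = (edgeNormal b (!σ) * w).im := by
  cases σ <;> simp [edgeNormal_true_eq, edgeNormal_false_eq, Complex.mul_im]

theorem mem_pskConstellation_iff {L : ℕ} {s : ℂ} :
    s ∈ pskConstellation L ↔ ∃ i < L, s =
      Complex.exp (((Real.pi / 4 : ℝ) : ℂ) * Complex.I) *
        Complex.exp (((2 * (Real.pi / L) : ℝ) : ℂ) * Complex.I) ^ i := by
  have (i : ℕ) : Complex.exp (((Real.pi / 4 + 2 * Real.pi / L * i : ℝ) : ℂ) * Complex.I) =
      Complex.exp (((Real.pi / 4 : ℝ) : ℂ) * Complex.I) *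
        Complex.exp (((2 * (Real.pi / L) : ℝ) : ℂ) * Complex.I) ^ i := by
    rw [← Complex.exp_nat_mul, ← Complex.exp_add]
    congr 1
    push_cast
    ring
  simp only [pskConstellation, Set.mem_ofPred_eq, this]

theorem norm_of_mem_pskConstellation {L : ℕ} {s : ℂ} (hs : s ∈ pskConstellation L) : ‖s‖ = 1 := by
  obtain ⟨i, -, rfl⟩ := hs
  rw [Complex.norm_exp_ofReal_mul_I]

theorem pskConstellation_finite (L : ℕ) : (pskConstellation L).Finite := by
  refine ((Set.finite_lt_nat L).image fun i : ℕ ↦ Complex.exp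
    (((Real.pi / 4 + 2 * Real.pi / L * i : ℝ) : ℂ) * Complex.I)).subset ?_
  rintro s ⟨i, hi, rfl⟩
  exact ⟨i, hi, rfl⟩

theorem pskConstellation_nonempty {L : ℕ} (hL : 0 < L) : (pskConstellation L).Nonempty :=
  ⟨_, 0, hL, rfl⟩

theorem exp_two_pi_div_pow {L : ℕ} (hL : 0 < L) :
    Complex.exp (((2 * (Real.pi / L) : ℝ) : ℂ) * Complex.I) ^ L = 1 := by
  rw [← Complex.exp_nat_mul]
  convert Complex.exp_two_pi_mul_I using 2
  have : (L : ℂ) ≠ 0 := by exact_mod_cast hL.ne'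
  push_cast
  field_simp

theorem mul_pow_mem_pskConstellation {L : ℕ} {s : ℂ} (hs : s ∈ pskConstellation L) (m : ℕ) :
    s * Complex.exp (((2 * (Real.pi / L) : ℝ) : ℂ) * Complex.I) ^ m ∈ pskConstellation L := by
  rw [mem_pskConstellation_iff] at hs ⊢
  obtain ⟨i, hi, rfl⟩ := hs
  have hL : 0 < L := by omega
  refine ⟨(i + m) % L, Nat.mod_lt _ hL, ?_⟩
  rw [mul_assoc, ← pow_add, ← pow_mod_orderOf _ (i + m)]
  congr 1
  rw [← pow_mod_orderOf _ ((i + m) % L), Nat.mod_mod_of_dvd]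
  exact orderOf_dvd_of_pow_eq_one (exp_two_pi_div_pow hL)

theorem exists_eq_mul_pow_of_mem_pskConstellation {L : ℕ} {s s' : ℂ}
    (hs : s ∈ pskConstellation L) (hs' : s' ∈ pskConstellation L) :
    ∃ m < L, s' = s * Complex.exp (((2 * (Real.pi / L) : ℝ) : ℂ) * Complex.I) ^ m := by
  rw [mem_pskConstellation_iff] at hs hs'
  obtain ⟨i, hi, rfl⟩ := hs
  obtain ⟨j, hj, rfl⟩ := hs'
  have hL : 0 < L := by omega
  refine ⟨(j + (L - i)) % L, Nat.mod_lt _ hL, ?_⟩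
  set ζ := Complex.exp (((2 * (Real.pi / L) : ℝ) : ℂ) * Complex.I) with hζ
  have h1 : ζ ^ L = 1 := exp_two_pi_div_pow hL
  have h2 : ζ ^ ((j + (L - i)) % L) = ζ ^ (j + (L - i)) := by
    conv_rhs => rw [← Nat.div_add_mod (j + (L - i)) L, pow_add, pow_mul, h1, one_pow, one_mul]
  rw [h2, mul_assoc, ← pow_add, show i + (j + (L - i)) = j + L by omega, pow_add, h1, mul_one]

theorem exp_two_mul_pow (a : ℝ) (m : ℕ) :
    Complex.exp (((2 * a : ℝ) : ℂ) * Complex.I) ^ m =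
      ⟨1 - 2 * Real.sin (m * a) ^ 2, 2 * Real.sin (m * a) * Real.cos (m * a)⟩ := by
  have : Complex.exp (((2 * a : ℝ) : ℂ) * Complex.I) ^ m =
      Complex.exp (((2 * (m * a) : ℝ) : ℂ) * Complex.I) := by
    rw [← Complex.exp_nat_mul]
    congr 1
    push_cast
    ring
  rw [this]
  apply Complex.ext
  · simp only [Complex.exp_ofReal_mul_I_re]
    rw [Real.cos_two_mul, Real.cos_sq']
    ring
  · simp only [Complex.exp_ofReal_mul_I_im]
    rw [Real.sin_two_mul]

namespace IsPhaseQuantizer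

variable {L : ℕ} {Q : ℂ → ℂ}

theorem norm_eq (hQ : IsPhaseQuantizer L Q) (x : ℂ) : ‖Q x‖ = 1 :=
  norm_of_mem_pskConstellation (hQ.mem x)

theorem re_conj_mul_le (hQ : IsPhaseQuantizer L Q) (x : ℂ) {s : ℂ} (hs : s ∈ pskConstellation L) :
    (conj s * x).re ≤ (conj (Q x) * x).re := by
  have h := hQ.isMin x s hs
  have h1 := hQ.norm_eq x
  have h2 := norm_of_mem_pskConstellation hs
  have h3 : ‖Q x - x‖ ^ 2 ≤ ‖s - x‖ ^ 2 := by gcongr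
  have key (w : ℂ) (hw : ‖w‖ = 1) : ‖w - x‖ ^ 2 = 1 - 2 * (conj w * x).re + ‖x‖ ^ 2 := by
    have : ‖w‖ ^ 2 = 1 := by rw [hw, one_pow]
    rw [Complex.sq_norm, Complex.normSq_apply] at this ⊢
    rw [Complex.sq_norm, Complex.normSq_apply]
    simp only [Complex.sub_re, Complex.sub_im, Complex.mul_re, Complex.conj_re, Complex.conj_im]
    linear_combination this
  rw [key _ h1, key _ h2] at h3
  linarith

/-- The difference of the correlations of `x` with two constellation points `2 θ` apart. -/
theorem re_sub_re_rotate (s x : ℂ) (θ : ℝ) :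
    (conj s * x).re - (conj (s * ⟨1 - 2 * Real.sin θ ^ 2, 2 * Real.sin θ * Real.cos θ⟩) * x).re =
      2 * Real.sin θ *
        (Real.sin θ * (conj s * x).re - Real.cos θ * (conj s * x).im) := by
  simp only [Complex.mul_re, Complex.mul_im, map_mul, Complex.conj_re, Complex.conj_im]
  ring

/-- Only the two neighbouring constellation points matter: comparing `Q x` with each of them gives
one edge of its closed decision sector. -/
theorem im_nonneg (hQ : IsPhaseQuantizer L Q) (hL : 2 ≤ L) (x : ℂ) (σ : Bool) :
    0 ≤ (edgeNormal (Real.pi / L) σ * (conj (Q x) * x)).im := by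
  have hL' : (2 : ℝ) ≤ L := by exact_mod_cast hL
  have ha : 0 < Real.sin (Real.pi / L) := by
    apply Real.sin_pos_of_pos_of_lt_pi
    · positivity
    · rw [div_lt_iff₀ (by positivity)]
      nlinarith [Real.pi_pos]
  have key (m : ℕ) : 0 ≤ 2 * Real.sin (m * (Real.pi / L)) *
      (Real.sin (m * (Real.pi / L)) * (conj (Q x) * x).re -
        Real.cos (m * (Real.pi / L)) * (conj (Q x) * x).im) := by
    rw [← re_sub_re_rotate, ← exp_two_mul_pow]
    exact sub_nonneg.2 (hQ.re_conj_mul_le x (mul_pow_mem_pskConstellation (hQ.mem x) m))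
  cases σ
  · have := key 1
    rw [edgeNormal_false_eq, Complex.mul_im]
    simp only [Nat.cast_one, one_mul] at this
    have := nonneg_of_mul_nonneg_right this (by positivity)
    simp only
    linarith
  -- Exponents are natural numbers, so the preceding neighbour is reached by `L - 1` forward
  -- rotations.
  · have := key (L - 1)
    rw [edgeNormal_true_eq, Complex.mul_im]
    have e : ((L - 1 : ℕ) : ℝ) * (Real.pi / L) = Real.pi - Real.pi / L := by
      rw [Nat.cast_sub (by omega)]
      field_simp
      simp
    rw [e, Real.sin_pi_sub, Real.cos_pi_sub] at this
    have := nonneg_of_mul_nonneg_right this (by positivity)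
    simp only
    linarith

/-- Any other point is a rotation by `2θ` with `π/L ≤ θ ≤ π - π/L`. There `sin θ ≥ sin (π/L)` and
`|cos θ| ≤ cos (π/L)`, so the two edge inequalities already make the correlation with `s` strictly
larger. -/
theorem eq_of_im_pos (hQ : IsPhaseQuantizer L Q) (hL : 2 ≤ L) {x s : ℂ}
    (hs : s ∈ pskConstellation L)
    (h : ∀ σ, 0 < (edgeNormal (Real.pi / L) σ * (conj s * x)).im) : Q x = s := by
  have hL' : (2 : ℝ) ≤ L := by exact_mod_cast hL
  have hpi := Real.pi_pos
  set a := Real.pi / L with ha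
  have ha0 : 0 < a := by positivity
  have haL : L * a = Real.pi := by rw [ha]; field_simp
  obtain ⟨m, hm, e⟩ := exists_eq_mul_pow_of_mem_pskConstellation hs (hQ.mem x)
  rcases Nat.eq_zero_or_pos m with rfl | hm0
  · simpa using e
  exfalso
  have h1 := hQ.re_conj_mul_le x hs
  rw [e, ← ha, exp_two_mul_pow, ← sub_nonpos, re_sub_re_rotate] at h1
  set u := (conj s * x).re
  set v := (conj s * x).im
  have hf := h false
  have ht := h true
  rw [edgeNormal_false_eq, Complex.mul_im] at hf
  rw [edgeNormal_true_eq, Complex.mul_im] at ht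
  change 0 < -Real.cos a * v + Real.sin a * u at hf
  change 0 < Real.cos a * v + Real.sin a * u at ht
  have hm0' : (1 : ℝ) ≤ m := by exact_mod_cast hm0
  have hm' : (m : ℝ) + 1 ≤ L := by exact_mod_cast hm
  set θ := m * a with hθ
  have hθ1 : a ≤ θ := by nlinarith
  have hθ2 : θ ≤ Real.pi - a := by nlinarith
  have hsa : 0 < Real.sin a := Real.sin_pos_of_pos_of_lt_pi ha0 (by linarith)
  have hsθ : 0 < Real.sin θ := Real.sin_pos_of_pos_of_lt_pi (by linarith) (by linarith)
  have hu : 0 < u := by nlinarith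
  have hss : Real.sin a ≤ Real.sin θ := by
    rcases le_total θ (Real.pi / 2) with h | h
    · exact Real.sin_le_sin_of_le_of_le_pi_div_two (by linarith) h hθ1
    · rw [← Real.sin_pi_sub θ]
      exact Real.sin_le_sin_of_le_of_le_pi_div_two (by linarith) (by linarith) (by linarith)
  have hc1 : Real.cos θ ≤ Real.cos a := Real.cos_le_cos_of_nonneg_of_le_pi ha0.le (by linarith) hθ1
  have hc2 : -Real.cos a ≤ Real.cos θ := by
    rw [← Real.cos_pi_sub]
    exact Real.cos_le_cos_of_nonneg_of_le_pi (by linarith) (by linarith) hθ2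
  have : 0 < Real.sin θ * u - Real.cos θ * v := by
    rcases le_total 0 v with hv | hv <;> nlinarith
  nlinarith [mul_pos hsθ this]

end IsPhaseQuantizer

/-! ### Null hyperplanes and irrelevance of ties -/

theorem volume_linear_eq_zero {E : Type*} [NormedAddCommGroup E] [NormedSpace ℝ E]
    [MeasurableSpace E] [BorelSpace E] [FiniteDimensional ℝ E] (μ : Measure E)
    [μ.IsAddHaarMeasure] (l : E →ₗ[ℝ] ℝ) (hl : l ≠ 0) (t : ℝ) : μ {z | l z = t} = 0 := by
  obtain ⟨v, hv⟩ : ∃ v, l v ≠ 0 := by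
    by_contra! h
    exact hl (LinearMap.ext h)
  have e : {z | l z = t} = (fun z ↦ z + (-(t / l v) • v)) ⁻¹' (LinearMap.ker l : Set E) := by
    ext z
    simp only [Set.mem_ofPred_eq, Set.mem_preimage, SetLike.mem_coe, LinearMap.mem_ker, map_add,
      map_smul, smul_eq_mul]
    rw [neg_mul, div_mul_cancel₀ _ hv, ← sub_eq_add_neg, sub_eq_zero]
  rw [e, measure_preimage_add_right]
  refine Measure.addHaar_submodule μ _ fun h ↦ hl (LinearMap.ker_eq_top.1 h)

theorem volume_im_sum_eq_zero {N : ℕ} (c : Fin N → ℂ) (i : Fin N) (hc : c i ≠ 0) (t : ℝ) :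
    volume {z : Fin N → ℂ | ∑ i, (c i * z i).im = t} = 0 := by
  let l : (Fin N → ℂ) →ₗ[ℝ] ℝ :=
    { toFun z := ∑ i, (c i * z i).im
      map_add' z w := by simp [mul_add, Finset.sum_add_distrib]
      map_smul' r z := by
        simp only [Pi.smul_apply, Complex.real_smul, RingHom.id_apply, smul_eq_mul, Finset.mul_sum]
        refine Finset.sum_congr rfl fun i _ ↦ ?_
        rw [mul_left_comm, Complex.im_ofReal_mul] }
  refine volume_linear_eq_zero volume l (fun h ↦ ?_) t
  have h1 := LinearMap.congr_fun h (Pi.single i (Complex.I / c i))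
  change ∑ j, (c j * (Pi.single i (Complex.I / c i) : Fin N → ℂ) j).im = 0 at h1
  rw [Finset.sum_eq_single i (fun j _ hj ↦ by simp [hj]) (by simp), Pi.single_eq_same,
    mul_div_cancel₀ _ hc] at h1
  simp at h1

theorem volume_im_mul_eq_zero {c : ℂ} (hc : c ≠ 0) : volume {z : ℂ | (c * z).im = 0} = 0 := by
  let l : ℂ →ₗ[ℝ] ℝ :=
    { toFun z := (c * z).im
      map_add' z w := by simp [mul_add]
      map_smul' r z := by
        simp only [Complex.real_smul, RingHom.id_apply, smul_eq_mul]
        rw [mul_left_comm, Complex.im_ofReal_mul] }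
  refine volume_linear_eq_zero volume l (fun h ↦ ?_) 0
  have h1 := LinearMap.congr_fun h (Complex.I / c)
  change (c * (Complex.I / c)).im = 0 at h1
  rw [mul_div_cancel₀ _ hc] at h1
  simp at h1

theorem measurePreserving_mul_of_norm_eq_one {c : ℂ} (hc : ‖c‖ = 1) :
    MeasurePreserving (fun z : ℂ ↦ c * z) volume volume := by
  have := (rotation ⟨c, by simpa [Submonoid.unitSphere] using hc⟩).measurePreserving
  exact this

/-- The open sector of half-angle `b` around the positive real axis. -/
def openSector (b : ℝ) : Set ℂ := {w | ∀ σ, 0 < (edgeNormal b σ * w).im}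

theorem measurableSet_openSector (b : ℝ) : MeasurableSet (openSector b) := by
  have : openSector b = ⋂ σ, {w | 0 < (edgeNormal b σ * w).im} := by
    ext; simp [openSector]
  rw [this]
  refine MeasurableSet.iInter fun σ ↦ measurableSet_lt measurable_const ?_
  fun_prop

/-- The closed and open decision sectors differ by boundary lines, which are null; this is why the
tie-breaking rule never matters. -/
theorem IsPhaseQuantizer.ae_iff {L : ℕ} {Q : ℂ → ℂ} (hQ : IsPhaseQuantizer L Q) (hL : 2 ≤ L) :
    ∀ᵐ y : ℂ, ∀ s ∈ pskConstellation L, Q y = s ↔ conj s * y ∈ openSector (Real.pi / L) := by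
  refine (ae_ball_iff (pskConstellation_finite L).countable).2 fun s hs ↦ ?_
  have hs1 := norm_of_mem_pskConstellation hs
  have h (σ : Bool) : ∀ᵐ y : ℂ, ((edgeNormal (Real.pi / L) σ * conj s) * y).im ≠ 0 := by
    refine measure_eq_zero_iff_ae_notMem.1 (volume_im_mul_eq_zero ?_)
    rw [← norm_ne_zero_iff, norm_mul, norm_edgeNormal, RCLike.norm_conj, hs1]
    simp
  filter_upwards [h true, h false] with y h1 h2
  constructor
  · rintro rfl σ
    refine lt_of_le_of_ne (hQ.im_nonneg hL y σ) (Ne.symm ?_)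
    rw [← mul_assoc]
    cases σ <;> assumption
  · exact hQ.eq_of_im_pos hL hs

theorem IsPhaseQuantizer.ae_eq {L : ℕ} {Q Q' : ℂ → ℂ} (hQ : IsPhaseQuantizer L Q)
    (hQ' : IsPhaseQuantizer L Q') (hL : 2 ≤ L) : Q =ᵐ[volume] Q' := by
  filter_upwards [hQ.ae_iff hL, hQ'.ae_iff hL] with y h h'
  exact ((h' _ (hQ.mem y)).2 ((h _ (hQ.mem y)).1 rfl)).symm

/-! ### Push-forward of Lebesgue measure under an edge functional -/

theorem card_pskConstellation (L : ℕ) (hL : 0 < L) :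
    (pskConstellation_finite L).toFinset.card = L := by
  have hp : IsPrimitiveRoot (Complex.exp (((2 * (Real.pi / L) : ℝ) : ℂ) * Complex.I)) L := by
    convert Complex.isPrimitiveRoot_exp L hL.ne' using 2
    push_cast
    ring
  have : (pskConstellation_finite L).toFinset = (Finset.range L).image fun i ↦
      Complex.exp (((Real.pi / 4 : ℝ) : ℂ) * Complex.I) *
        Complex.exp (((2 * (Real.pi / L) : ℝ) : ℂ) * Complex.I) ^ i := by
    ext s
    simp only [Set.Finite.mem_toFinset, mem_pskConstellation_iff, Finset.mem_image,
      Finset.mem_range, eq_comm]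
  rw [this, Finset.card_image_of_injOn, Finset.card_range]
  intro i hi j hj h
  exact hp.pow_inj (Finset.mem_range.1 hi) (Finset.mem_range.1 hj)
    (mul_left_cancel₀ (Complex.exp_ne_zero _) h)

/-- The plane splits, up to a null set, into `L` decision sectors, and rotation by `conj s` carries
each of them onto the same sector preserving area. -/
theorem lintegral_quantizer {L : ℕ} {Q : ℂ → ℂ} (hQ : IsPhaseQuantizer L Q) (hL : 2 ≤ L)
    {f : ℂ → ℝ≥0∞} (hf : Measurable f) :
    ∫⁻ y, f (conj (Q y) * y) = L * ∫⁻ w in openSector (Real.pi / L), f w := by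
  have h1 : ∫⁻ y, f (conj (Q y) * y) = ∫⁻ y, ∑ s ∈ (pskConstellation_finite L).toFinset,
      (openSector (Real.pi / L)).indicator f (conj s * y) := by
    refine lintegral_congr_ae ?_
    filter_upwards [hQ.ae_iff hL] with y hy
    rw [Finset.sum_eq_single (Q y), Set.indicator_of_mem]
    · exact (hy _ (hQ.mem y)).1 rfl
    · intro s hs hne
      rw [Set.indicator_of_notMem]
      exact fun h ↦ hne ((hy s ((pskConstellation_finite L).mem_toFinset.1 hs)).2 h).symm
    · intro h
      exact absurd ((pskConstellation_finite L).mem_toFinset.2 (hQ.mem y)) h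
  have hm : Measurable ((openSector (Real.pi / L)).indicator f) :=
    hf.indicator (measurableSet_openSector _)
  rw [h1, lintegral_finsetSum _ (fun s _ ↦ by fun_prop)]
  rw [Finset.sum_congr rfl (g := fun _ ↦ ∫⁻ w in openSector (Real.pi / L), f w), Finset.sum_const,
    card_pskConstellation L (by omega), nsmul_eq_mul]
  intro s hs
  have hs1 := norm_of_mem_pskConstellation ((pskConstellation_finite L).mem_toFinset.1 hs)
  rw [← lintegral_indicator (measurableSet_openSector _)]
  exact (measurePreserving_mul_of_norm_eq_one (c := conj s)
    (by rw [RCLike.norm_conj, hs1])).lintegral_comp hm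

theorem lintegral_Ioi_comp_mul {f : ℝ → ℝ≥0∞} (hf : Measurable f) {k : ℝ} (hk : 0 < k) :
    ∫⁻ r in Set.Ioi 0, ENNReal.ofReal r * f (k * r) =
      ENNReal.ofReal (1 / k ^ 2) * ∫⁻ x in Set.Ioi 0, ENNReal.ofReal x * f x := by
  set g : ℝ → ℝ≥0∞ := (Set.Ioi 0).indicator fun x ↦ ENNReal.ofReal x * f x with hg
  have hgm : Measurable g := by
    refine Measurable.indicator ?_ measurableSet_Ioi
    fun_prop
  have h1 : ∫⁻ r, g (k * r) = ENNReal.ofReal (1 / k) * ∫⁻ x, g x := by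
    rw [← lintegral_map hgm (measurable_const_mul k), Real.map_volume_mul_left hk.ne',
      lintegral_smul_measure, abs_of_pos (by positivity), one_div, smul_eq_mul]
  have h2 : ∫⁻ r in Set.Ioi 0, ENNReal.ofReal r * f (k * r) =
      ENNReal.ofReal (1 / k) * ∫⁻ r, g (k * r) := by
    rw [← lintegral_const_mul _ (by fun_prop),
      ← lintegral_indicator measurableSet_Ioi]
    refine lintegral_congr fun r ↦ ?_
    by_cases hr : 0 < r
    · rw [hg, Set.indicator_of_mem (show r ∈ Set.Ioi 0 from hr),
        Set.indicator_of_mem (show k * r ∈ Set.Ioi 0 from mul_pos hk hr), ← mul_assoc,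
        ← ENNReal.ofReal_mul (by positivity)]
      congr 2
      field_simp
    · rw [hg, Set.indicator_of_notMem (show r ∉ Set.Ioi 0 from hr),
        Set.indicator_of_notMem (show k * r ∉ Set.Ioi 0 from fun h ↦ hr (pos_of_mul_pos_right h hk.le)),
        mul_zero]
  rw [h2, h1, hg, lintegral_indicator measurableSet_Ioi, ← mul_assoc,
    ← ENNReal.ofReal_mul (by positivity)]
  congr 2
  field_simp

theorem Real.hasDerivAt_cot {x : ℝ} (hx : Real.sin x ≠ 0) :
    HasDerivAt Real.cot (-(1 / Real.sin x ^ 2)) x := by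
  have h := (Real.hasDerivAt_cos x).div (Real.hasDerivAt_sin x) hx
  have e : Real.cot = fun x ↦ Real.cos x / Real.sin x := funext Real.cot_eq_cos_div_sin
  rw [e]
  refine h.congr_deriv ?_
  rw [← neg_div]
  congr 1
  linear_combination -Real.sin_sq_add_cos_sq x

/-- The angle, measured from the edge of the sector of half-angle `b` with normal
`edgeNormal b σ`. -/
def edgeAngle (b : ℝ) (σ : Bool) (θ : ℝ) : ℝ := if σ then b + θ else b - θ

theorem im_edgeNormal_mul_polar (b r θ : ℝ) (σ : Bool) :
    (edgeNormal b σ * (r * (Real.cos θ + Real.sin θ * Complex.I))).im =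
      Real.sin (edgeAngle b σ θ) * r := by
  have h : (r : ℂ) * (Real.cos θ + Real.sin θ * Complex.I) = ⟨r * Real.cos θ, r * Real.sin θ⟩ := by
    apply Complex.ext <;> simp [-Complex.ofReal_cos, -Complex.ofReal_sin]
  rw [h]
  cases σ
  · simp only [edgeNormal_false_eq, Complex.mul_im, edgeAngle, Bool.false_eq_true, if_false,
      Real.sin_sub]
    ring
  · simp only [edgeNormal_true_eq, Complex.mul_im, edgeAngle, if_true, Real.sin_add]
    ring

theorem sin_edgeAngle_pos {a b : ℝ} (hab : a < b) (hb : b ≤ Real.pi / 2) (σ : Bool) {θ : ℝ}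
    (hθ : θ ∈ Set.Icc (-a) a) : 0 < Real.sin (edgeAngle b σ θ) := by
  obtain ⟨h1, h2⟩ := hθ
  apply Real.sin_pos_of_pos_of_lt_pi <;> cases σ <;> simp [edgeAngle] <;> linarith

theorem lintegral_sin_edgeAngle {a b : ℝ} (ha : 0 < a) (hab : a < b) (hb : b ≤ Real.pi / 2)
    (σ : Bool) :
    ∫⁻ θ in Set.Ioo (-a) a, ENNReal.ofReal (1 / Real.sin (edgeAngle b σ θ) ^ 2) =
      ENNReal.ofReal (Real.cot (b - a) - Real.cot (b + a)) := by
  have hcont : ContinuousOn (fun θ ↦ 1 / Real.sin (edgeAngle b σ θ) ^ 2) (Set.Icc (-a) a) := by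
    refine ContinuousOn.div continuousOn_const (Continuous.continuousOn ?_) fun θ hθ ↦
      pow_ne_zero _ (sin_edgeAngle_pos hab hb σ hθ).ne'
    unfold edgeAngle
    cases σ <;> simp <;> fun_prop
  have hle : -a ≤ a := by linarith
  have hint : IntervalIntegrable (fun θ ↦ 1 / Real.sin (edgeAngle b σ θ) ^ 2) volume (-a) a :=
    ContinuousOn.intervalIntegrable (by rwa [Set.uIcc_of_le hle])
  have hI : ∫ θ in (-a)..a, 1 / Real.sin (edgeAngle b σ θ) ^ 2 =
      Real.cot (b - a) - Real.cot (b + a) := by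
    cases σ
    · rw [intervalIntegral.integral_eq_sub_of_hasDerivAt (f := fun θ ↦ Real.cot (b - θ)) _ hint]
      · simp
      · intro θ hθ
        rw [Set.uIcc_of_le hle] at hθ
        have hp := sin_edgeAngle_pos hab hb false hθ
        simp only [edgeAngle, Bool.false_eq_true, if_false] at hp ⊢
        have := HasDerivAt.comp θ (h := fun θ ↦ b - θ) (Real.hasDerivAt_cot hp.ne')
          ((hasDerivAt_id θ).const_sub b)
        exact this.congr_deriv (by ring)
    · rw [intervalIntegral.integral_eq_sub_of_hasDerivAt (f := fun θ ↦ -Real.cot (b + θ)) _ hint]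
      · simp only [← sub_eq_add_neg]; ring
      · intro θ hθ
        rw [Set.uIcc_of_le hle] at hθ
        have hp := sin_edgeAngle_pos hab hb true hθ
        simp only [edgeAngle, if_true] at hp ⊢
        have := (HasDerivAt.comp θ (h := fun θ ↦ b + θ) (Real.hasDerivAt_cot hp.ne')
          ((hasDerivAt_id θ).const_add b)).neg
        exact this.congr_deriv (by ring)
  rw [← hI, intervalIntegral.integral_of_le hle, ofReal_integral_eq_lintegral_ofReal hint.1
    (ae_of_all _ fun θ ↦ by positivity)]
  exact setLIntegral_congr Ioo_ae_eq_Ioc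

theorem polar_mem_openSector_iff {a r θ : ℝ} (ha : 0 < a) (ha' : a ≤ Real.pi / 2) (hr : 0 < r)
    (hθ : θ ∈ Set.Ioo (-Real.pi) Real.pi) :
    (r * (Real.cos θ + Real.sin θ * Complex.I) : ℂ) ∈ openSector a ↔ θ ∈ Set.Ioo (-a) a := by
  obtain ⟨h1, h2⟩ := hθ
  simp only [openSector, Set.mem_ofPred_eq, im_edgeNormal_mul_polar, mul_pos_iff_of_pos_right hr,
    Bool.forall_bool, edgeAngle, Bool.false_eq_true, if_false, if_true, Set.mem_Ioo]
  constructor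
  · rintro ⟨h3, h4⟩
    constructor
    · by_contra! h
      exact h4.not_ge (Real.sin_nonpos_of_nonpos_of_neg_pi_le (by linarith) (by linarith))
    · by_contra! h
      exact h3.not_ge (Real.sin_nonpos_of_nonpos_of_neg_pi_le (by linarith) (by linarith))
  · rintro ⟨h3, h4⟩
    constructor <;> apply Real.sin_pos_of_pos_of_lt_pi <;> linarith

/-- In polar coordinates the functional is `r sin (b ± θ)`. Substituting `x` for it turns `r dr`
into `x dx / sin²`, and the integral of `1 / sin²` over the angle is the difference of cotangents.
-/
theorem setLIntegral_openSector {a b : ℝ} (ha : 0 < a) (hab : a < b) (hb : b ≤ Real.pi / 2)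
    (σ : Bool) {f : ℝ → ℝ≥0∞} (hf : Measurable f) :
    ∫⁻ w in openSector a, f (edgeNormal b σ * w).im =
      ENNReal.ofReal (Real.cot (b - a) - Real.cot (b + a)) *
        ∫⁻ x in Set.Ioi 0, ENNReal.ofReal x * f x := by
  rw [← lintegral_indicator (measurableSet_openSector _), ← Complex.lintegral_comp_polarCoord_symm]
  have h1 : ∀ p ∈ polarCoord.target, ENNReal.ofReal p.1 •
      (openSector a).indicator (fun w ↦ f (edgeNormal b σ * w).im) (Complex.polarCoord.symm p) =
      (Set.univ ×ˢ Set.Ioo (-a) a).indicator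
        (fun p ↦ ENNReal.ofReal p.1 * f (Real.sin (edgeAngle b σ p.2) * p.1)) p := by
    rintro ⟨r, θ⟩ ⟨hr, hθ⟩
    rw [Complex.polarCoord_symm_apply]
    have := polar_mem_openSector_iff ha (by linarith) (r := r) hr hθ
    by_cases h : θ ∈ Set.Ioo (-a) a
    · rw [Set.indicator_of_mem (this.2 h), im_edgeNormal_mul_polar, Set.indicator_of_mem]
      · rfl
      · exact ⟨trivial, h⟩
    · rw [Set.indicator_of_notMem (fun h' ↦ h (this.1 h')), Set.indicator_of_notMem, smul_zero]
      exact fun h' ↦ h h'.2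
  have hmeas : Measurable fun p : ℝ × ℝ ↦
      ENNReal.ofReal p.1 * f (Real.sin (edgeAngle b σ p.2) * p.1) := by
    unfold edgeAngle
    cases σ <;> simp <;> fun_prop
  rw [setLIntegral_congr_fun polarCoord.open_target.measurableSet h1,
    lintegral_indicator (MeasurableSet.univ.prod measurableSet_Ioo),
    Measure.restrict_restrict (MeasurableSet.univ.prod measurableSet_Ioo)]
  have h2 : (Set.univ ×ˢ Set.Ioo (-a) a) ∩ polarCoord.target =
      Set.Ioi (0 : ℝ) ×ˢ Set.Ioo (-a) a := by
    ext ⟨r, θ⟩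
    simp only [polarCoord_target, Set.mem_inter_iff, Set.mem_prod, Set.mem_univ, true_and,
      Set.mem_Ioi, Set.mem_Ioo]
    constructor
    · tauto
    · rintro ⟨h1, h2, h3⟩
      refine ⟨⟨h2, h3⟩, h1, ?_, ?_⟩ <;> linarith
  rw [h2, Measure.volume_eq_prod, setLIntegral_prod_symm _ hmeas.aemeasurable]
  rw [setLIntegral_congr_fun (g := fun θ ↦ ENNReal.ofReal (1 / Real.sin (edgeAngle b σ θ) ^ 2) *
    ∫⁻ x in Set.Ioi 0, ENNReal.ofReal x * f x) measurableSet_Ioo, lintegral_mul_const,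
    lintegral_sin_edgeAngle ha hab hb]
  · unfold edgeAngle
    cases σ <;> simp <;> fun_prop
  · intro θ hθ
    exact lintegral_Ioi_comp_mul hf (sin_edgeAngle_pos hab hb σ ⟨hθ.1.le, hθ.2.le⟩)

/-- The push-forward of Lebesgue measure under `y ↦ Im (e conj(Q y) y)`, `e` an edge normal of the
sector of half-angle `b`, has density proportional to `x` on the half-line. -/
theorem lintegral_edgeNormal_quantizer {L : ℕ} {Q : ℂ → ℂ} (hQ : IsPhaseQuantizer L Q)
    (hL : 2 ≤ L) {b : ℝ} (hLb : Real.pi / L < b) (hb : b ≤ Real.pi / 2) (σ : Bool)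
    {f : ℝ → ℝ≥0∞} (hf : Measurable f) :
    ∫⁻ y, f (edgeNormal b σ * (conj (Q y) * y)).im =
      ENNReal.ofReal (L * (Real.cot (b - Real.pi / L) - Real.cot (b + Real.pi / L))) *
        ∫⁻ x in Set.Ioi 0, ENNReal.ofReal x * f x := by
  have ha : 0 < Real.pi / L := div_pos Real.pi_pos (by exact_mod_cast (by omega : 0 < L))
  rw [lintegral_quantizer hQ hL (f := fun w ↦ f (edgeNormal b σ * w).im) (by fun_prop),
    setLIntegral_openSector ha hLb hb σ hf, ENNReal.ofReal_mul (by positivity),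
    ENNReal.ofReal_natCast, mul_assoc]

/-! ### Volume of sublevel sets of a sum -/

theorem integral_mul_sub_pow (t : ℝ) (m : ℕ) :
    ∫ x in (0 : ℝ)..t, x * (t - x) ^ m = t ^ (m + 2) / ((m + 1) * (m + 2)) := by
  have hd (x : ℝ) : HasDerivAt (fun x ↦ -(x * (t - x) ^ (m + 1) / (m + 1)) -
      (t - x) ^ (m + 2) / ((m + 1) * (m + 2))) (x * (t - x) ^ m) x := by
    have h1 : HasDerivAt (fun x ↦ t - x) (-1) x := (hasDerivAt_id x).const_sub t
    have h2 := h1.pow (m + 1)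
    have h3 := h1.pow (m + 2)
    refine ((((hasDerivAt_id x).mul h2).div_const _).neg.sub (h3.div_const _)).congr_deriv ?_
    have : (m : ℝ) + 1 ≠ 0 := by positivity
    have : (m : ℝ) + 2 ≠ 0 := by positivity
    simp only [Pi.pow_apply, id]
    push_cast
    field_simp
    ring
  rw [intervalIntegral.integral_eq_sub_of_hasDerivAt (fun x _ ↦ hd x)
    (by apply Continuous.intervalIntegrable; fun_prop)]
  simp

/-- The hypothesis says that `X` pushes Lebesgue measure to `κ x dx` on the half-line. Splitting off
one coordinate leaves the beta-type integral of `x (t - x) ^ (2N)`, which raises the exponent by two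
and supplies the two new factorial factors. -/
theorem volume_sum_lt {X : ℂ → ℝ} (hX : Measurable X) (hX0 : ∀ y, 0 ≤ X y) {κ : ℝ} (hκ : 0 ≤ κ)
    (h : ∀ f : ℝ → ℝ≥0∞, Measurable f → ∫⁻ y, f (X y) =
      ENNReal.ofReal κ * ∫⁻ x in Set.Ioi 0, ENNReal.ofReal x * f x) (N : ℕ) {t : ℝ} (ht : 0 < t) :
    volume {y : Fin N → ℂ | ∑ i, X (y i) < t} =
      ENNReal.ofReal (κ ^ N * t ^ (2 * N) / (2 * N)!) := by
  induction N generalizing t with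
  | zero =>
    simp [ht, volume_pi]
  | succ N ih =>
    have hm : MeasurableSet {p : ℂ × (Fin N → ℂ) | X p.1 + ∑ i, X (p.2 i) < t} :=
      measurableSet_lt (by fun_prop) measurable_const
    have h1 := (volume_preserving_piFinSuccAbove (fun _ : Fin (N + 1) ↦ ℂ) 0).measure_preimage
      hm.nullMeasurableSet
    have h2 : (MeasurableEquiv.piFinSuccAbove (fun _ : Fin (N + 1) ↦ ℂ) 0) ⁻¹'
        {p | X p.1 + ∑ i, X (p.2 i) < t} = {y | ∑ i, X (y i) < t} := by
      ext y
      simp [Fin.sum_univ_succ, MeasurableEquiv.piFinSuccAbove, Fin.tail]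
    rw [h2] at h1
    set f : ℝ → ℝ≥0∞ := (Set.Iio t).indicator fun x ↦
      ENNReal.ofReal (κ ^ N * (t - x) ^ (2 * N) / (2 * N)!) with hf
    have h3 (y : ℂ) : volume (Prod.mk y ⁻¹' {p : ℂ × (Fin N → ℂ) | X p.1 + ∑ i, X (p.2 i) < t}) =
        f (X y) := by
      have : Prod.mk y ⁻¹' {p : ℂ × (Fin N → ℂ) | X p.1 + ∑ i, X (p.2 i) < t} =
          {y' | ∑ i, X (y' i) < t - X y} := by
        ext y'
        simp [lt_sub_iff_add_lt']
      rw [this]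
      by_cases hy : X y < t
      · rw [ih (sub_pos.2 hy), hf, Set.indicator_of_mem (by exact hy)]
      · rw [hf, Set.indicator_of_notMem (by exact hy)]
        convert measure_empty (μ := volume)
        refine Set.eq_empty_of_forall_notMem fun y' hy' ↦ ?_
        have : 0 ≤ ∑ i, X (y' i) := Finset.sum_nonneg fun i _ ↦ hX0 _
        simp only [Set.mem_ofPred_eq] at hy'
        linarith
    rw [h1, Measure.volume_eq_prod, Measure.prod_apply hm]
    simp_rw [h3]
    rw [h f (Measurable.indicator (by fun_prop) measurableSet_Iio)]
    have h4 : ∫⁻ x in Set.Ioi 0, ENNReal.ofReal x * f x = ENNReal.ofReal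
        (∫ x in (0 : ℝ)..t, κ ^ N / (2 * N)! * (x * (t - x) ^ (2 * N))) := by
      rw [intervalIntegral.integral_of_le ht.le, ofReal_integral_eq_lintegral_ofReal,
        setLIntegral_congr Ioo_ae_eq_Ioc.symm, ← lintegral_indicator measurableSet_Ioi,
        ← lintegral_indicator measurableSet_Ioo]
      · refine lintegral_congr fun x ↦ ?_
        by_cases hx : x ∈ Set.Ioo 0 t
        · rw [Set.indicator_of_mem hx, Set.indicator_of_mem (show x ∈ Set.Ioi 0 from hx.1), hf,
            Set.indicator_of_mem (show x ∈ Set.Iio t from hx.2), ← ENNReal.ofReal_mul hx.1.le]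
          congr 1
          ring
        · rw [Set.indicator_of_notMem hx, hf]
          by_cases h0 : 0 < x
          · rw [Set.indicator_of_mem (show x ∈ Set.Ioi 0 from h0), Set.indicator_of_notMem,
              mul_zero]
            exact fun h' ↦ hx ⟨h0, h'⟩
          · rw [Set.indicator_of_notMem (show x ∉ Set.Ioi 0 from h0)]
      · exact Continuous.integrableOn_Ioc (by fun_prop)
      · refine (ae_restrict_iff' measurableSet_Ioc).2 (ae_of_all _ fun x hx ↦ ?_)
        have : 0 ≤ t - x := sub_nonneg.2 hx.2
        have := hx.1.le
        simp only [Pi.zero_apply]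
        positivity
    rw [h4, ← ENNReal.ofReal_mul hκ, intervalIntegral.integral_const_mul, integral_mul_sub_pow]
    congr 1
    rw [show 2 * (N + 1) = 2 * N + 1 + 1 by ring, Nat.factorial_succ, Nat.factorial_succ]
    push_cast
    have : ((2 * N)! : ℝ) ≠ 0 := by positivity
    field_simp
    ring

/-! ### Projections and moments of the standard complex Gaussian -/

theorem MeasureTheory.MeasurePreserving.withDensity_comp {α β : Type*} [MeasurableSpace α]
    [MeasurableSpace β] {μ : Measure α} {ν : Measure β} {e : α → β} (he : MeasurePreserving e μ ν)
    {f : β → ℝ≥0∞} (hf : Measurable f) :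
    MeasurePreserving e (μ.withDensity fun x ↦ f (e x)) (ν.withDensity f) := by
  refine ⟨he.measurable, ?_⟩
  ext s hs
  rw [Measure.map_apply he.measurable hs, withDensity_apply _ (he.measurable hs),
    withDensity_apply _ hs, he.setLIntegral_comp_preimage hs hf]

/-- The standard complex Gaussian distribution on `ℂ`. -/
noncomputable def stdComplexGaussian : Measure ℂ :=
  volume.withDensity fun z ↦ ENNReal.ofReal (Real.exp (-‖z‖ ^ 2) / Real.pi)

theorem measurePreserving_equivRealProd_stdComplexGaussian :
    MeasurePreserving Complex.measurableEquivRealProd stdComplexGaussian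
      ((gaussianReal 0 (1 / 2)).prod (gaussianReal 0 (1 / 2))) := by
  have hv : (1 / 2 : ℝ≥0) ≠ 0 := by norm_num
  rw [gaussianReal_of_var_ne_zero _ hv, prod_withDensity (measurable_gaussianPDF _ _)
    (measurable_gaussianPDF _ _)]
  have := Complex.volume_preserving_equiv_real_prod.withDensity_comp
    (f := fun p ↦ gaussianPDF 0 (1 / 2) p.1 * gaussianPDF 0 (1 / 2) p.2)
    (by have := measurable_gaussianPDF 0 (1 / 2); fun_prop)
  rw [Measure.volume_eq_prod] at this
  convert this using 1
  rw [stdComplexGaussian]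
  congr 1
  ext z
  rw [gaussianPDF, gaussianPDF, ← ENNReal.ofReal_mul (gaussianPDFReal_nonneg _ _ _)]
  congr 1
  simp only [gaussianPDFReal, Complex.measurableEquivRealProd_apply]
  have h1 : Real.sqrt (2 * Real.pi * ((1 / 2 : ℝ≥0) : ℝ)) = Real.sqrt Real.pi := by
    congr 1
    push_cast
    ring
  rw [h1, Complex.sq_norm, Complex.normSq_apply]
  have h2 : Real.sqrt Real.pi * Real.sqrt Real.pi = Real.pi := Real.mul_self_sqrt Real.pi_pos.le
  rw [mul_mul_mul_comm, ← mul_inv, h2, ← Real.exp_add, div_eq_inv_mul]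
  congr 2
  push_cast
  ring

instance : IsProbabilityMeasure stdComplexGaussian := by
  have h := measurePreserving_equivRealProd_stdComplexGaussian
  constructor
  have := h.measure_preimage MeasurableSet.univ.nullMeasurableSet
  rw [Set.preimage_univ] at this
  rw [this]
  exact measure_univ

theorem map_im_stdComplexGaussian :
    stdComplexGaussian.map Complex.im = gaussianReal 0 (1 / 2) := by
  have h := measurePreserving_equivRealProd_stdComplexGaussian
  have e : Complex.im = Prod.snd ∘ Complex.measurableEquivRealProd := by
    ext z; simp [Complex.measurableEquivRealProd_apply]
  rw [e, ← Measure.map_map measurable_snd Complex.measurableEquivRealProd.measurable, h.map_eq,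
    Measure.map_snd_prod, measure_univ, one_smul]

theorem map_im_mul_stdComplexGaussian {c : ℂ} (hc : ‖c‖ = 1) :
    stdComplexGaussian.map (fun z ↦ (c * z).im) = gaussianReal 0 (1 / 2) := by
  have h := (measurePreserving_mul_of_norm_eq_one hc).withDensity_comp
    (f := fun z ↦ ENNReal.ofReal (Real.exp (-‖z‖ ^ 2) / Real.pi)) (by fun_prop)
  simp only [norm_mul, hc, one_mul] at h
  change MeasurePreserving _ stdComplexGaussian stdComplexGaussian at h
  rw [← map_im_stdComplexGaussian]
  conv_rhs => rw [← h.map_eq, Measure.map_map Complex.measurable_im h.measurable]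
  rfl

theorem map_sum_pi_gaussianReal {α : Type*} [MeasurableSpace α] {μ : Measure α}
    [IsProbabilityMeasure μ] {v : ℝ≥0} (N : ℕ) (f : Fin N → α → ℝ) (hf : ∀ i, Measurable (f i))
    (h : ∀ i, μ.map (f i) = gaussianReal 0 v) :
    (Measure.pi fun _ : Fin N ↦ μ).map (fun z ↦ ∑ i, f i (z i)) = gaussianReal 0 (N * v) := by
  induction N with
  | zero =>
    simp [Measure.map_const]
  | succ N ih =>
    have hg : Measurable fun z : Fin N → α ↦ ∑ i, f i.succ (z i) := by fun_prop
    have e : (fun z : Fin (N + 1) → α ↦ ∑ i, f i (z i)) =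
        (fun p : ℝ × ℝ ↦ p.1 + p.2) ∘ (Prod.map (f 0) fun z : Fin N → α ↦ ∑ i, f i.succ (z i)) ∘
          MeasurableEquiv.piFinSuccAbove (fun _ : Fin (N + 1) ↦ α) 0 := by
      ext z
      simp [Fin.sum_univ_succ, MeasurableEquiv.piFinSuccAbove, Fin.tail]
    have hp := measurePreserving_piFinSuccAbove (fun _ : Fin (N + 1) ↦ μ) 0
    rw [e, ← Measure.map_map (by fun_prop) (by fun_prop), ← Measure.map_map (by fun_prop)
      hp.measurable, hp.map_eq, ← Measure.map_prod_map _ _ (hf 0) hg, h 0,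
      ih (fun i ↦ f i.succ) (fun i ↦ hf _) fun i ↦ h _]
    change (gaussianReal 0 v).conv _ = _
    rw [gaussianReal_conv_gaussianReal, add_zero]
    congr 1
    push_cast
    ring

theorem complexGaussian_one_density {N : ℕ} (z : Fin N → ℂ) :
    Real.exp (-(star z ⬝ᵥ ((1 : Matrix (Fin N) (Fin N) ℂ)⁻¹ *ᵥ z)).re) /
      (Real.pi ^ N * (1 : Matrix (Fin N) (Fin N) ℂ).det.re) =
      ∏ i, (Real.exp (-‖z i‖ ^ 2) / Real.pi) := by
  rw [inv_one, Matrix.one_mulVec, Matrix.det_one, Complex.one_re, mul_one, Finset.prod_div_distrib,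
    ← Real.exp_sum, Finset.prod_const, Finset.card_univ, Fintype.card_fin, Finset.sum_neg_distrib]
  congr 3
  rw [dotProduct, Complex.re_sum]
  refine Finset.sum_congr rfl fun i _ ↦ ?_
  rw [Complex.sq_norm, Complex.normSq_apply]
  simp

theorem integrable_exp_neg_mul_norm_sq {c : ℝ} (hc : 0 < c) :
    Integrable fun z : ℂ ↦ Real.exp (-c * ‖z‖ ^ 2) := by
  have := (GaussianFourier.integrable_cexp_neg_mul_sq_norm_add (V := ℂ) (b := c)
    (by simpa using hc) 0 0).norm
  refine this.congr (ae_of_all _ fun z ↦ ?_)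
  simp only [Complex.norm_exp]
  congr 1
  simp [← Complex.ofReal_pow]

theorem complexGaussian_one_eq_pi (N : ℕ) :
    complexGaussian (1 : Matrix (Fin N) (Fin N) ℂ) = Measure.pi fun _ ↦ stdComplexGaussian := by
  symm
  refine Measure.pi_eq fun s hs ↦ ?_
  have hint : Integrable fun z : ℂ ↦ Real.exp (-‖z‖ ^ 2) / Real.pi := by
    simpa using (integrable_exp_neg_mul_norm_sq one_pos).div_const Real.pi
  unfold complexGaussian
  simp_rw [complexGaussian_one_density]
  rw [withDensity_apply _ (MeasurableSet.univ_pi hs), volume_pi, Measure.restrict_pi_pi,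
    ← ofReal_integral_eq_lintegral_ofReal
      (Integrable.fintype_prod (f := fun _ z ↦ Real.exp (-‖z‖ ^ 2) / Real.pi)
        fun i ↦ hint.restrict)
      (ae_of_all _ fun z ↦ Finset.prod_nonneg fun i _ ↦ by positivity),
    integral_fintype_prod_eq_prod fun _ z ↦ Real.exp (-‖z‖ ^ 2) / Real.pi,
    ENNReal.ofReal_prod_of_nonneg fun i _ ↦ integral_nonneg fun z ↦ by positivity]
  refine Finset.prod_congr rfl fun i _ ↦ ?_
  rw [stdComplexGaussian, withDensity_apply _ (hs i), ofReal_integral_eq_lintegral_ofReal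
    hint.restrict (ae_of_all _ fun z ↦ by positivity)]

instance (N : ℕ) : IsProbabilityMeasure (complexGaussian (1 : Matrix (Fin N) (Fin N) ℂ)) := by
  rw [complexGaussian_one_eq_pi]
  infer_instance

/-- By circular symmetry the phases `c i` drop out. They will depend on the received vector, and
this is what decouples noise from signal. -/
theorem map_sum_im_complexGaussian_one {N : ℕ} {c : Fin N → ℂ} (hc : ∀ i, ‖c i‖ = 1) :
    (complexGaussian (1 : Matrix (Fin N) (Fin N) ℂ)).map (fun z ↦ ∑ i, (c i * z i).im) =
      gaussianReal 0 (N * (1 / 2)) := by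
  rw [complexGaussian_one_eq_pi]
  exact map_sum_pi_gaussianReal N (fun i z ↦ (c i * z).im) (fun i ↦ by fun_prop)
    fun i ↦ map_im_mul_stdComplexGaussian (hc i)

theorem lintegral_pow_gaussianReal {N : ℕ} (hN : 1 ≤ N) :
    ∫⁻ g in Set.Ioi 0, ENNReal.ofReal (g ^ (2 * N)) ∂(gaussianReal 0 (N * (1 / 2))) =
      ENNReal.ofReal (N ^ N * Real.Gamma (N + 1 / 2) / (2 * Real.sqrt Real.pi)) := by
  have hN0 : (0 : ℝ) < N := by exact_mod_cast hN
  have hv : (N * (1 / 2) : ℝ≥0) ≠ 0 := by positivity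
  have key := integral_rpow_mul_exp_neg_mul_rpow (p := 2) (q := 2 * N) (b := 1 / N) (by norm_num)
    (by linarith) (by positivity)
  have hint : IntegrableOn (fun x : ℝ ↦ x ^ (2 * N : ℝ) * Real.exp (-(1 / N) * x ^ (2 : ℝ)))
      (Set.Ioi 0) := by
    -- The Bochner integral of a non-integrable function is zero, so the nonzero closed form `key`
    -- yields integrability.
    refine Integrable.of_integral_ne_zero ?_
    rw [key]
    have : 0 < Real.Gamma ((2 * N + 1) / 2 : ℝ) := Real.Gamma_pos_of_pos (by positivity)
    positivity
  rw [gaussianReal_of_var_ne_zero _ hv, restrict_withDensity measurableSet_Ioi,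
    lintegral_withDensity_eq_lintegral_mul _ (measurable_gaussianPDF _ _) (by fun_prop)]
  have e : ∫⁻ g in Set.Ioi 0, (gaussianPDF 0 (N * (1 / 2)) * fun g ↦ ENNReal.ofReal (g ^ (2 * N))) g
      = ∫⁻ x in Set.Ioi 0, ENNReal.ofReal ((Real.sqrt (Real.pi * N))⁻¹ *
        (x ^ (2 * N : ℝ) * Real.exp (-(1 / N) * x ^ (2 : ℝ)))) := by
    refine setLIntegral_congr_fun measurableSet_Ioi fun x hx ↦ ?_
    have hx0 : 0 < x := hx
    simp only [Pi.mul_apply, gaussianPDF]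
    rw [← ENNReal.ofReal_mul (gaussianPDFReal_nonneg _ _ _), gaussianPDFReal]
    congr 1
    have h1 : x ^ (2 * N : ℝ) = x ^ (2 * N) := by
      rw [← Real.rpow_natCast]; push_cast; rfl
    have h2 : x ^ (2 : ℝ) = x ^ 2 := by exact_mod_cast Real.rpow_natCast x 2
    have h3 : 2 * Real.pi * ((N * (1 / 2) : ℝ≥0) : ℝ) = Real.pi * N := by push_cast; ring
    have h4 : -(x - 0) ^ 2 / (2 * ((N * (1 / 2) : ℝ≥0) : ℝ)) = -(1 / N) * x ^ 2 := by
      push_cast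
      field_simp
      ring
    rw [h1, h2, h3, h4, mul_assoc, mul_comm (Real.exp _)]
  rw [e, ← ofReal_integral_eq_lintegral_ofReal (hint.const_mul _), integral_const_mul, key]
  · congr 1
    have h3 : (1 / N : ℝ) ^ (-(2 * N + 1) / 2 : ℝ) = N ^ N * Real.sqrt N := by
      rw [one_div, Real.inv_rpow hN0.le, ← Real.rpow_neg hN0.le,
        show -(-(2 * N + 1) / 2 : ℝ) = N + 1 / 2 by ring, Real.rpow_add hN0, Real.rpow_natCast,
        Real.sqrt_eq_rpow]
    rw [h3, Real.sqrt_mul Real.pi_pos.le, show ((2 * N + 1) / 2 : ℝ) = N + 1 / 2 by ring]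
    have := Real.sqrt_pos.2 hN0
    have := Real.sqrt_pos.2 Real.pi_pos
    field_simp
  · refine (ae_restrict_iff' measurableSet_Ioi).2 (ae_of_all _ fun x hx ↦ ?_)
    have : (0 : ℝ) < x := hx
    simp only [Pi.zero_apply]
    positivity

/-! ### The limiting error set and its measure -/

/-- The pairs `(y, z)` of received vectors and noise vectors for which, in the high SNR limit, the
combined signal lies beyond the edge of the decision region with normal `edgeNormal b σ`. -/
def edgeErrorSet (N : ℕ) (Q : ℂ → ℂ) (b : ℝ) (σ : Bool) : Set ((Fin N → ℂ) × (Fin N → ℂ)) :=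
  {p | ∑ i, (edgeNormal b σ * (conj (Q (p.1 i)) * (p.1 i - p.2 i))).im < 0}

theorem measurableSet_edgeErrorSet (N : ℕ) {Q : ℂ → ℂ} (hQ : Measurable Q) (b : ℝ) (σ : Bool) :
    MeasurableSet (edgeErrorSet N Q b σ) :=
  measurableSet_lt (by fun_prop) measurable_const

/-- The limiting error measure beyond one edge, where `D` is the difference of cotangents. -/
noncomputable def edgeErrorValue (N n : ℕ) (D : ℝ) : ℝ :=
  (2 ^ n * D) ^ N / (2 * N)! * (N ^ N * Real.Gamma (N + 1 / 2) / (2 * Real.sqrt Real.pi))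

/-- The derotated signal lies in a closed sector strictly inside the sector of half-angle `b`, so
its edge functional is bounded below linearly. With `L ≥ 3` the two edges of the inner sector are
linearly independent. -/
theorem IsPhaseQuantizer.edge_pos {L : ℕ} {Q : ℂ → ℂ} (hQ : IsPhaseQuantizer L Q) (hL : 3 ≤ L)
    {b : ℝ} (hLb : Real.pi / L < b) (hb : b ≤ Real.pi / 2) :
    ∃ c > 0, ∀ y σ, c * ‖y‖ ≤ (edgeNormal b σ * (conj (Q y) * y)).im := by
  have hL' : (3 : ℝ) ≤ L := by exact_mod_cast hL
  have hpi := Real.pi_pos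
  set a := Real.pi / L with ha
  have ha0 : 0 < a := by positivity
  have h2a : 0 < Real.sin (2 * a) := by
    apply Real.sin_pos_of_pos_of_lt_pi (by positivity)
    rw [ha, mul_div_assoc', div_lt_iff₀ (by positivity)]
    nlinarith
  have h1 : 0 < Real.sin (b - a) := Real.sin_pos_of_pos_of_lt_pi (by linarith) (by linarith)
  have h2 : 0 < Real.sin (b + a) := Real.sin_pos_of_pos_of_lt_pi (by linarith) (by linarith)
  refine ⟨min (Real.sin (b - a)) (Real.sin (b + a)), lt_min h1 h2, fun y σ ↦ ?_⟩
  set c := min (Real.sin (b - a)) (Real.sin (b + a)) with hc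
  have hc0 : 0 < c := lt_min h1 h2
  have hc1 : c ≤ Real.sin (b - a) := min_le_left _ _
  have hc2 : c ≤ Real.sin (b + a) := min_le_right _ _
  set t := conj (Q y) * y with ht
  have hty : ‖t‖ = ‖y‖ := by rw [ht, norm_mul, RCLike.norm_conj, hQ.norm_eq, one_mul]
  have hp := hQ.im_nonneg (by omega) y true
  have hq := hQ.im_nonneg (by omega) y false
  rw [← ht, ← ha] at hp hq
  set p := (edgeNormal a true * t).im with hp'
  set q := (edgeNormal a false * t).im with hq'
  have hsum : Real.sin (2 * a) * ‖y‖ ≤ p + q := by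
    -- Expanding `t` in the two inner edge normals, with the nonnegative edge values `p`, `q` as
    -- coefficients up to sign, bounds `‖y‖` by the triangle inequality; the outer edge values are
    -- nonnegative combinations of the same `p`, `q`.
    have e : ((Real.sin (2 * a) : ℝ) : ℂ) * t =
        p * edgeNormal a true - q * edgeNormal a false := by
      rw [hp', hq', Real.sin_two_mul]
      apply Complex.ext
      · simp only [edgeNormal_true_eq, edgeNormal_false_eq, Complex.sub_re, Complex.re_ofReal_mul,
          Complex.mul_im]
        ring
      · simp only [edgeNormal_true_eq, edgeNormal_false_eq, Complex.sub_im, Complex.mul_im,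
          Complex.ofReal_re, Complex.ofReal_im]
        ring
    calc Real.sin (2 * a) * ‖y‖ = ‖((Real.sin (2 * a) : ℝ) : ℂ) * t‖ := by
          rw [norm_mul, Complex.norm_real, Real.norm_of_nonneg h2a.le, hty]
      _ ≤ ‖(p : ℂ) * edgeNormal a true‖ + ‖(q : ℂ) * edgeNormal a false‖ := by
          rw [e]
          exact norm_sub_le _ _
      _ = p + q := by
          simp only [norm_mul, norm_edgeNormal, Complex.norm_real, Real.norm_of_nonneg hp,
            Real.norm_of_nonneg hq, mul_one]
  have hσ : Real.sin (2 * a) * (edgeNormal b σ * t).im =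
      if σ then p * Real.sin (b + a) + q * Real.sin (b - a)
      else p * Real.sin (b - a) + q * Real.sin (b + a) := by
    rw [hp', hq', Real.sin_two_mul, Real.sin_add, Real.sin_sub]
    have := Real.sin_sq_add_cos_sq a
    cases σ
    · simp only [edgeNormal_true_eq, edgeNormal_false_eq, Complex.mul_im, Bool.false_eq_true,
        if_false]
      ring
    · simp only [edgeNormal_true_eq, edgeNormal_false_eq, Complex.mul_im, if_true]
      ring
  have hge : c * (p + q) ≤ Real.sin (2 * a) * (edgeNormal b σ * t).im := by
    rw [hσ]
    cases σ
    · simp only [Bool.false_eq_true, if_false]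
      nlinarith
    · simp only [if_true]
      nlinarith
  have := mul_le_mul_of_nonneg_left hsum hc0.le
  nlinarith

/-- Fubini is used in both orders: for fixed `y` the noise collapses to a real Gaussian `g` with law
independent of `y`; then for fixed `g` the volume in `y` is known. -/
theorem measure_edgeErrorSet {N n : ℕ} (hN : 1 ≤ N) {Q : ℂ → ℂ} (hn : 3 ≤ 2 ^ n)
    (hQ : IsPhaseQuantizer (2 ^ n) Q) {b : ℝ} (hb' : Real.pi / 2 ^ n < b) (hb : b ≤ Real.pi / 2)
    (hD : 0 ≤ Real.cot (b - Real.pi / 2 ^ n) - Real.cot (b + Real.pi / 2 ^ n)) (σ : Bool) :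
    ((volume : Measure (Fin N → ℂ)).prod (complexGaussian 1)) (edgeErrorSet N Q b σ) =
      ENNReal.ofReal (edgeErrorValue N n
        (Real.cot (b - Real.pi / 2 ^ n) - Real.cot (b + Real.pi / 2 ^ n))) := by
  set D := Real.cot (b - Real.pi / 2 ^ n) - Real.cot (b + Real.pi / 2 ^ n) with hDdef
  have hcast : ((2 ^ n : ℕ) : ℝ) = 2 ^ n := by push_cast; rfl
  obtain ⟨c, hc, hcX⟩ := hQ.edge_pos hn (b := b) (by rwa [hcast]) hb
  have hQm := hQ.measurable
  set X : ℂ → ℝ := fun y ↦ (edgeNormal b σ * (conj (Q y) * y)).im with hX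
  have hXm : Measurable X := by fun_prop
  have hX0 (y : ℂ) : 0 ≤ X y := (by positivity : 0 ≤ c * ‖y‖).trans (hcX y σ)
  set G := gaussianReal 0 (N * (1 / 2)) with hG
  have hκ : 0 ≤ 2 ^ n * D := by positivity
  have hV (t : ℝ) (ht : 0 < t) := volume_sum_lt hXm hX0 hκ (fun f hf ↦ by
    have := lintegral_edgeNormal_quantizer hQ (by omega) (by rwa [hcast]) hb σ hf
    rwa [hcast, ← hDdef] at this) N ht
  have hS : MeasurableSet {p : (Fin N → ℂ) × ℝ | ∑ i, X (p.1 i) < p.2} :=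
    measurableSet_lt (by fun_prop) measurable_snd
  have h1 : ((volume : Measure (Fin N → ℂ)).prod (complexGaussian 1)) (edgeErrorSet N Q b σ) =
      (volume.prod G) {p : (Fin N → ℂ) × ℝ | ∑ i, X (p.1 i) < p.2} := by
    rw [Measure.prod_apply (measurableSet_edgeErrorSet N hQm b σ), Measure.prod_apply hS]
    refine lintegral_congr fun y ↦ ?_
    rw [hG, ← map_sum_im_complexGaussian_one (c := fun i ↦ edgeNormal b σ * conj (Q (y i)))
      (fun i ↦ by rw [norm_mul, norm_edgeNormal, RCLike.norm_conj, hQ.norm_eq, one_mul]),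
      Measure.map_apply (by fun_prop) (hS.preimage measurable_prodMk_left)]
    congr 1
    ext z
    simp only [edgeErrorSet, Set.mem_preimage, Set.mem_ofPred_eq, hX]
    simp only [mul_sub, Complex.sub_im, mul_assoc, Finset.sum_sub_distrib, sub_neg]
  rw [h1, Measure.prod_apply_symm hS]
  have h2 (g : ℝ) : volume ((fun y : Fin N → ℂ ↦ (y, g)) ⁻¹'
      {p : (Fin N → ℂ) × ℝ | ∑ i, X (p.1 i) < p.2}) = (Set.Ioi 0).indicator
        (fun g ↦ ENNReal.ofReal ((2 ^ n * D) ^ N / (2 * N)!) * ENNReal.ofReal (g ^ (2 * N))) g := by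
    by_cases hg : 0 < g
    · rw [Set.indicator_of_mem (show g ∈ Set.Ioi 0 from hg),
        ← ENNReal.ofReal_mul (by positivity), div_mul_eq_mul_div, ← hV g hg]
      rfl
    · rw [Set.indicator_of_notMem (show g ∉ Set.Ioi 0 from hg)]
      convert measure_empty (μ := volume)
      refine Set.eq_empty_of_forall_notMem fun y hy ↦ hg ?_
      exact (Finset.sum_nonneg fun i _ ↦ hX0 (y i)).trans_lt hy
  simp_rw [h2]
  rw [lintegral_indicator measurableSet_Ioi, lintegral_const_mul _ (by fun_prop), hG,
    lintegral_pow_gaussianReal hN, ← ENNReal.ofReal_mul (by positivity)]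
  rfl

/-- The limiting error set of the receiver. -/
def limitErrorSet (N : ℕ) (Q : ℂ → ℂ) (b : ℝ) : Set ((Fin N → ℂ) × (Fin N → ℂ)) :=
  {p | ∃ σ, p ∈ edgeErrorSet N Q b σ}

theorem measurableSet_limitErrorSet (N : ℕ) {Q : ℂ → ℂ} (hQ : Measurable Q) (b : ℝ) :
    MeasurableSet (limitErrorSet N Q b) := by
  have : limitErrorSet N Q b = ⋃ σ, edgeErrorSet N Q b σ := by
    ext; simp [limitErrorSet]
  rw [this]
  exact MeasurableSet.iUnion fun σ ↦ measurableSet_edgeErrorSet N hQ b σ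

theorem measure_limitErrorSet_congr {N L : ℕ} {Q Q' : ℂ → ℂ} (hQ : IsPhaseQuantizer L Q)
    (hQ' : IsPhaseQuantizer L Q') (hL : 2 ≤ L) (b : ℝ) :
    ((volume : Measure (Fin N → ℂ)).prod (complexGaussian 1)) (limitErrorSet N Q b) =
      ((volume : Measure (Fin N → ℂ)).prod (complexGaussian 1)) (limitErrorSet N Q' b) := by
  have h : ∀ᵐ y : Fin N → ℂ, ∀ i, Q (y i) = Q' (y i) := by
    rw [ae_all_iff]
    intro i
    exact (Measure.quasiMeasurePreserving_eval (fun _ : Fin N ↦ (volume : Measure ℂ)) i).ae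
      (hQ.ae_eq hQ' hL)
  refine measure_congr ?_
  filter_upwards [Measure.quasiMeasurePreserving_fst.ae h] with p hp
  refine propext ?_
  change p ∈ limitErrorSet N Q b ↔ p ∈ limitErrorSet N Q' b
  simp only [limitErrorSet, edgeErrorSet, Set.mem_ofPred_eq, hp]

/-! ### The combiner matrix at high SNR -/

theorem Matrix.PosDef.sqrt_eq_cfc {N : ℕ} {K : Matrix (Fin N) (Fin N) ℂ} (hK : K.PosDef)
    {f : ℝ → ℝ} (hf : ∀ x ∈ spectrum ℝ K, 0 ≤ f x) :
    CFC.sqrt (cfc f K) = cfc (fun x ↦ Real.sqrt (f x)) K := by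
  have hfin : (spectrum ℝ K).Finite := Matrix.finite_real_spectrum
  have hsa : IsSelfAdjoint K := hK.isHermitian
  refine CFC.sqrt_unique ?_ ?_
  · rw [← cfc_mul _ _ K (hfin.continuousOn _) (hfin.continuousOn _)]
    exact cfc_congr fun x hx ↦ Real.mul_self_sqrt (hf x hx)
  · exact cfc_nonneg fun x _ ↦ Real.sqrt_nonneg _

theorem Matrix.PosDef.spectrum_pos {N : ℕ} {K : Matrix (Fin N) (Fin N) ℂ} (hK : K.PosDef)
    {x : ℝ} (hx : x ∈ spectrum ℝ K) : 0 < x := by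
  rw [hK.isHermitian.spectrum_real_eq_range_eigenvalues] at hx
  obtain ⟨i, rfl⟩ := hx
  exact hK.eigenvalues_pos i

theorem amrc_matrix_eq {N : ℕ} {K : Matrix (Fin N) (Fin N) ℂ} (hK : K.PosDef) {ρ : ℝ}
    (hρ : 0 < ρ) :
    CFC.sqrt (receivedCovariance ρ K) * (CFC.sqrt K)⁻¹ =
      cfc (fun x ↦ Real.sqrt (ρ * x + 1) * (Real.sqrt x)⁻¹) K := by
  have hfin : (spectrum ℝ K).Finite := Matrix.finite_real_spectrum
  have hsa : IsSelfAdjoint K := hK.isHermitian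
  have h1 : receivedCovariance ρ K = cfc (fun x ↦ ρ * x + 1) K := by
    rw [cfc_add_const _ _ K, cfc_const_mul_id _ K, map_one]
    rfl
  have h2 : CFC.sqrt (receivedCovariance ρ K) = cfc (fun x ↦ Real.sqrt (ρ * x + 1)) K := by
    rw [h1]
    refine hK.sqrt_eq_cfc fun x hx ↦ ?_
    have := hK.spectrum_pos hx
    positivity
  have h3 : CFC.sqrt K = cfc Real.sqrt K := by
    have := hK.sqrt_eq_cfc (f := id) fun x hx ↦ (hK.spectrum_pos hx).le
    rwa [cfc_id ℝ K] at this
  have h4 : (CFC.sqrt K)⁻¹ = cfc (fun x ↦ (Real.sqrt x)⁻¹) K := by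
    refine Matrix.inv_eq_right_inv ?_
    rw [h3, ← cfc_mul _ _ K (hfin.continuousOn _) (hfin.continuousOn _), ← cfc_one ℝ K]
    exact cfc_congr fun x hx ↦ mul_inv_cancel₀ (Real.sqrt_pos.2 (hK.spectrum_pos hx)).ne'
  rw [h2, h4, cfc_mul _ _ K (hfin.continuousOn _) (hfin.continuousOn _)]

/-- The matrix is a function of `K`, so in an eigenbasis of `K` it is diagonal with entries `√(1 + 1
/ (ρ x))` over the eigenvalues `x > 0`. -/
theorem tendsto_amrc_matrix {N : ℕ} {K : Matrix (Fin N) (Fin N) ℂ} (hK : K.PosDef) :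
    Tendsto (fun ρ : ℝ ↦ (Real.sqrt ρ)⁻¹ •
      (CFC.sqrt (receivedCovariance ρ K) * (CFC.sqrt K)⁻¹)) atTop (𝓝 1) := by
  have hlim (x : ℝ) (hx : 0 < x) : Tendsto (fun ρ : ℝ ↦
      (Real.sqrt ρ)⁻¹ * (Real.sqrt (ρ * x + 1) * (Real.sqrt x)⁻¹)) atTop (𝓝 1) := by
    have h1 : Tendsto (fun ρ : ℝ ↦ Real.sqrt (1 + (ρ * x)⁻¹)) atTop (𝓝 1) := by
      have : Tendsto (fun ρ : ℝ ↦ 1 + (ρ * x)⁻¹) atTop (𝓝 (1 + 0)) :=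
        tendsto_const_nhds.add (tendsto_inv_atTop_zero.comp (tendsto_id.atTop_mul_const hx))
      simpa [Function.comp_def] using (Real.continuous_sqrt.tendsto _).comp this
    refine h1.congr' ?_
    filter_upwards [eventually_gt_atTop 0] with ρ hρ
    rw [← Real.sqrt_inv, ← Real.sqrt_inv, ← Real.sqrt_mul (by positivity),
      ← Real.sqrt_mul (by positivity)]
    congr 1
    field_simp
  have h2 : Tendsto (fun ρ : ℝ ↦ (hK.isHermitian.eigenvectorUnitary : Matrix (Fin N) (Fin N) ℂ) *
      Matrix.diagonal (fun i ↦ (((Real.sqrt ρ)⁻¹ * (Real.sqrt (ρ * hK.isHermitian.eigenvalues i + 1)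
        * (Real.sqrt (hK.isHermitian.eigenvalues i))⁻¹) : ℝ) : ℂ)) *
      (star hK.isHermitian.eigenvectorUnitary : Matrix (Fin N) (Fin N) ℂ)) atTop (𝓝 1) := by
    have h3 : Tendsto (fun ρ : ℝ ↦ Matrix.diagonal (fun i ↦ (((Real.sqrt ρ)⁻¹ *
        (Real.sqrt (ρ * hK.isHermitian.eigenvalues i + 1)
        * (Real.sqrt (hK.isHermitian.eigenvalues i))⁻¹) : ℝ) : ℂ))) atTop
        (𝓝 (1 : Matrix (Fin N) (Fin N) ℂ)) := by
      rw [← Matrix.diagonal_one]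
      refine ((continuous_id.matrix_diagonal).tendsto _).comp (tendsto_pi_nhds.2 fun i ↦ ?_)
      have := (Complex.continuous_ofReal.tendsto _).comp (hlim _ (hK.eigenvalues_pos i))
      rw [Complex.ofReal_one] at this
      exact this
    have h4 := (h3.const_mul (hK.isHermitian.eigenvectorUnitary : Matrix (Fin N) (Fin N) ℂ)).mul_const
      (star hK.isHermitian.eigenvectorUnitary : Matrix (Fin N) (Fin N) ℂ)
    simpa using h4
  refine h2.congr' ?_
  filter_upwards [eventually_gt_atTop 0] with ρ hρ
  rw [amrc_matrix_eq hK hρ, hK.isHermitian.cfc_eq, Matrix.IsHermitian.cfc]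
  rw [Unitary.conjStarAlgAut_apply, ← Matrix.smul_mul, ← Matrix.mul_smul, ← Matrix.diagonal_smul]
  congr 3
  ext i
  simp

/-! ### The receiver in the coordinates `(y, z)` -/

/-- The matrix of the AMRC combiner, normalized so that it tends to the identity. -/
noncomputable def normalizedCombiner {N : ℕ} (K : Matrix (Fin N) (Fin N) ℂ) (ρ : ℝ) :
    Matrix (Fin N) (Fin N) ℂ :=
  (Real.sqrt ρ)⁻¹ • (CFC.sqrt (receivedCovariance ρ K) * (CFC.sqrt K)⁻¹)

/-- The channel vector for which the symbol `s` and the noise `z` produce the signal `y`. -/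
noncomputable def channelOf {N : ℕ} (ρ : ℝ) (s : ℂ) (y z : Fin N → ℂ) : Fin N → ℂ :=
  (Real.sqrt ρ)⁻¹ • (fun i ↦ conj s * (y i - z i))

/-- The combined signal, rotated by the transmitted symbol and conjugated. -/
noncomputable def derotatedStatistic {N : ℕ} (Q : ℂ → ℂ) (K : Matrix (Fin N) (Fin N) ℂ) (ρ : ℝ)
    (y z : Fin N → ℂ) : ℂ :=
  ∑ i, conj (Q (y i)) * (normalizedCombiner K ρ *ᵥ (y - z)) i

theorem receivedSignal_channelOf {N : ℕ} {ρ : ℝ} (hρ : 0 < ρ) {s : ℂ} (hs : ‖s‖ = 1)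
    (y z : Fin N → ℂ) : receivedSignal ρ s (channelOf ρ s y z) z = y := by
  ext i
  have h1 : (Real.sqrt ρ : ℂ) ≠ 0 := by exact_mod_cast (Real.sqrt_pos.2 hρ).ne'
  have h2 : conj s * s = 1 := by rw [Complex.conj_mul', hs]; simp
  simp only [receivedSignal, channelOf, Pi.smul_apply, Complex.real_smul, Complex.ofReal_inv]
  rw [mul_inv_cancel_left₀ h1, mul_right_comm, h2, one_mul, sub_add_cancel]

/-- The factor `1 / √ρ` of the channel is exactly the one that normalizes the combiner, so no
rescaling invariance of the detector is needed. -/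
theorem amrcEstimate_channelOf {N : ℕ} {Qadc Qdet : ℂ → ℂ} {K : Matrix (Fin N) (Fin N) ℂ} {ρ : ℝ}
    (hρ : 0 < ρ) {s : ℂ} (hs : ‖s‖ = 1) (y z : Fin N → ℂ) :
    amrcEstimate Qadc Qdet ρ K s (channelOf ρ s y z) z =
      Qdet (conj (conj s * derotatedStatistic Qadc K ρ y z)) := by
  have h2 : conj s * s = 1 := by rw [Complex.conj_mul', hs]; simp
  rw [amrcEstimate, receivedSignal_channelOf hρ hs]
  congr 1
  have h3 : amrcCombiner ρ K (channelOf ρ s y z) =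
      conj s • (normalizedCombiner K ρ *ᵥ (y - z)) := by
    have : (fun i ↦ conj s * (y i - z i)) = conj s • (y - z) := rfl
    rw [amrcCombiner, channelOf, normalizedCombiner, this, Matrix.mulVec_smul, Matrix.mulVec_smul,
      Matrix.smul_mulVec, smul_comm]
  rw [h3, derotatedStatistic, dotProduct, Finset.mul_sum, map_sum]
  refine Finset.sum_congr rfl fun i _ ↦ ?_
  simp only [Pi.star_apply, Pi.smul_apply, smul_eq_mul, star_mul', RCLike.star_def, map_mul,
    RCLike.conj_conj]
  ring

theorem amrcEstimate_eq_of_pos {N M : ℕ} {Qadc Qdet : ℂ → ℂ} (hM : 2 ≤ M)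
    (hQ : IsPhaseQuantizer M Qdet) {K : Matrix (Fin N) (Fin N) ℂ} {ρ : ℝ}
    (hρ : 0 < ρ) {s : ℂ} (hs : s ∈ pskConstellation M) {y z : Fin N → ℂ}
    (h : ∀ σ, 0 < (edgeNormal (Real.pi / M) σ * derotatedStatistic Qadc K ρ y z).im) :
    amrcEstimate Qadc Qdet ρ K s (channelOf ρ s y z) z = s := by
  have hs1 := norm_of_mem_pskConstellation hs
  have h2 : conj s * s = 1 := by rw [Complex.conj_mul', hs1]; simp
  rw [amrcEstimate_channelOf hρ hs1]
  refine hQ.eq_of_im_pos hM hs fun σ ↦ ?_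
  rw [map_mul, RCLike.conj_conj, ← mul_assoc (conj s), h2, one_mul, im_edgeNormal_mul_conj]
  exact h _

theorem amrcEstimate_ne_of_neg {N M : ℕ} {Qadc Qdet : ℂ → ℂ} (hM : 2 ≤ M)
    (hQ : IsPhaseQuantizer M Qdet) {K : Matrix (Fin N) (Fin N) ℂ} {ρ : ℝ}
    (hρ : 0 < ρ) {s : ℂ} (hs : s ∈ pskConstellation M) {y z : Fin N → ℂ} {σ : Bool}
    (h : (edgeNormal (Real.pi / M) σ * derotatedStatistic Qadc K ρ y z).im < 0) :
    amrcEstimate Qadc Qdet ρ K s (channelOf ρ s y z) z ≠ s := by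
  have hs1 := norm_of_mem_pskConstellation hs
  have h2 : conj s * s = 1 := by rw [Complex.conj_mul', hs1]; simp
  rw [amrcEstimate_channelOf hρ hs1]
  intro e
  have h3 := hQ.im_nonneg hM (conj (conj s * derotatedStatistic Qadc K ρ y z)) (!σ)
  rw [e, map_mul, RCLike.conj_conj, ← mul_assoc (conj s), h2, one_mul, im_edgeNormal_mul_conj,
    Bool.not_not] at h3
  exact h.not_ge h3

theorem tendsto_derotatedStatistic {N : ℕ} {K : Matrix (Fin N) (Fin N) ℂ} (hK : K.PosDef)
    (Q : ℂ → ℂ) (y z : Fin N → ℂ) :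
    Tendsto (fun ρ ↦ derotatedStatistic Q K ρ y z) atTop
      (𝓝 (∑ i, conj (Q (y i)) * (y i - z i))) := by
  have h1 : Tendsto (fun ρ ↦ normalizedCombiner K ρ *ᵥ (y - z)) atTop (𝓝 (y - z)) := by
    have h2 : Continuous fun B : Matrix (Fin N) (Fin N) ℂ ↦ B *ᵥ (y - z) :=
      continuous_id.matrix_mulVec continuous_const
    have := (h2.tendsto 1).comp (tendsto_amrc_matrix hK)
    rwa [Matrix.one_mulVec] at this
  refine tendsto_finsetSum _ fun i _ ↦ tendsto_const_nhds.mul ?_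
  exact (tendsto_pi_nhds.1 h1) i

/-! ### Uniform control of the error set -/

theorem eventually_norm_normalizedCombiner_sub_le {N : ℕ} {K : Matrix (Fin N) (Fin N) ℂ}
    (hK : K.PosDef) {ε : ℝ} (hε : 0 < ε) :
    ∀ᶠ ρ in atTop, ∀ u : Fin N → ℂ,
      ∑ i, ‖(normalizedCombiner K ρ *ᵥ u) i - u i‖ ≤ ε * ∑ i, ‖u i‖ := by
  have h := tendsto_amrc_matrix hK
  have h1 : ∀ᶠ ρ in atTop, ∀ i j, ‖normalizedCombiner K ρ i j -
      (1 : Matrix (Fin N) (Fin N) ℂ) i j‖ ≤ ε / (N + 1) := by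
    rw [eventually_all]
    intro i
    rw [eventually_all]
    intro j
    have h2 := (tendsto_pi_nhds.1 ((tendsto_pi_nhds.1 h) i)) j
    filter_upwards [(tendsto_iff_norm_sub_tendsto_zero.1 h2).eventually_le_const
      (show 0 < ε / (N + 1) by positivity)] with ρ hρ
    exact hρ
  filter_upwards [h1] with ρ hρ u
  have h2 (i : Fin N) : ‖(normalizedCombiner K ρ *ᵥ u) i - u i‖ ≤ ε / (N + 1) * ∑ i, ‖u i‖ := by
    have e : (normalizedCombiner K ρ *ᵥ u) i - u i =
        ∑ j, (normalizedCombiner K ρ i j - (1 : Matrix (Fin N) (Fin N) ℂ) i j) * u j := by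
      simp only [sub_mul, Finset.sum_sub_distrib]
      congr 1
      conv_lhs => rw [← Matrix.one_mulVec u]
      rfl
    rw [e, Finset.mul_sum]
    refine (norm_sum_le _ _).trans (Finset.sum_le_sum fun j _ ↦ ?_)
    rw [norm_mul]
    exact mul_le_mul_of_nonneg_right (hρ i j) (norm_nonneg _)
  calc ∑ i, ‖(normalizedCombiner K ρ *ᵥ u) i - u i‖
      ≤ ∑ i : Fin N, ε / (N + 1) * ∑ i, ‖u i‖ := Finset.sum_le_sum fun i _ ↦ h2 i
    _ = (N / (N + 1)) * (ε * ∑ i, ‖u i‖) := by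
        rw [Finset.sum_const, Finset.card_univ, Fintype.card_fin, nsmul_eq_mul]
        ring
    _ ≤ 1 * (ε * ∑ i, ‖u i‖) := by
        refine mul_le_mul_of_nonneg_right ?_ (by positivity)
        rw [div_le_one (by positivity)]
        linarith
    _ = _ := one_mul _

/-- Supplies the dominating set: for large `ρ`, simultaneously for all `(y, z)`, a signal large
compared with the noise is decoded correctly. -/
theorem exists_eventually_derotatedStatistic_pos {N L : ℕ} {Q : ℂ → ℂ}
    (hQ : IsPhaseQuantizer L Q) (hL : 3 ≤ L) {b : ℝ} (hLb : Real.pi / L < b)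
    (hb : b ≤ Real.pi / 2) {K : Matrix (Fin N) (Fin N) ℂ} (hK : K.PosDef) :
    ∃ C : ℝ, 0 ≤ C ∧ ∀ᶠ ρ in atTop, ∀ y z : Fin N → ℂ, C * ∑ i, ‖z i‖ < ∑ i, ‖y i‖ →
      ∀ σ, 0 < (edgeNormal b σ * derotatedStatistic Q K ρ y z).im := by
  obtain ⟨c, hc, hcX⟩ := hQ.edge_pos hL hLb hb
  -- The edge value is at least `c‖y‖ - ‖z‖ - ε(‖y‖ + ‖z‖) ≥ (c/2)‖y‖ - 2‖z‖` in sum norms, whence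
  -- the constant `4 / c`.
  set ε := min (c / 2) 1 with hε
  have hε0 : 0 < ε := lt_min (by positivity) one_pos
  have hε1 : ε ≤ c / 2 := min_le_left _ _
  have hε2 : ε ≤ 1 := min_le_right _ _
  refine ⟨4 / c, by positivity, ?_⟩
  filter_upwards [eventually_norm_normalizedCombiner_sub_le hK hε0] with ρ hρ y z hyz σ
  set u := y - z with hu
  have hy0 : 0 ≤ ∑ i, ‖y i‖ := by positivity
  have hz0 : 0 ≤ ∑ i, ‖z i‖ := by positivity
  have hu1 : ∑ i, ‖u i‖ ≤ ∑ i, ‖y i‖ + ∑ i, ‖z i‖ := by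
    rw [← Finset.sum_add_distrib]
    exact Finset.sum_le_sum fun i _ ↦ norm_sub_le _ _
  have him (i : Fin N) (w : ℂ) : -‖w‖ ≤ (edgeNormal b σ * (conj (Q (y i)) * w)).im := by
    refine neg_le_of_abs_le ((Complex.abs_im_le_norm _).trans_eq ?_)
    rw [norm_mul, norm_mul, norm_edgeNormal, RCLike.norm_conj, hQ.norm_eq, one_mul, one_mul]
  have e : (edgeNormal b σ * derotatedStatistic Q K ρ y z).im =
      ∑ i, ((edgeNormal b σ * (conj (Q (y i)) * y i)).im +
        (edgeNormal b σ * (conj (Q (y i)) * (-z i))).im +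
        (edgeNormal b σ * (conj (Q (y i)) * ((normalizedCombiner K ρ *ᵥ u) i - u i))).im) := by
    rw [derotatedStatistic, Finset.mul_sum, Complex.im_sum]
    refine Finset.sum_congr rfl fun i _ ↦ ?_
    rw [← Complex.add_im, ← Complex.add_im]
    congr 1
    simp only [hu, Pi.sub_apply]
    ring
  have h1 : c * ∑ i, ‖y i‖ - ∑ i, ‖z i‖ - ∑ i, ‖(normalizedCombiner K ρ *ᵥ u) i - u i‖ ≤
      (edgeNormal b σ * derotatedStatistic Q K ρ y z).im := by
    rw [e, Finset.mul_sum, ← Finset.sum_sub_distrib, ← Finset.sum_sub_distrib]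
    refine Finset.sum_le_sum fun i _ ↦ ?_
    have h2 := him i (-z i)
    have h3 := him i ((normalizedCombiner K ρ *ᵥ u) i - u i)
    rw [norm_neg] at h2
    have h4 := hcX (y i) σ
    linarith
  have h2 := hρ u
  have h3 : 4 * ∑ i, ‖z i‖ < c * ∑ i, ‖y i‖ := by
    rw [div_mul_eq_mul_div, div_lt_iff₀ hc] at hyz
    linarith
  nlinarith

/-- Where the noise controls the signal, half of the Gaussian exponent in `z` can be traded for
Gaussian decay in `y`, leaving an integrable product. -/
theorem measure_norm_le_lt_top {N : ℕ} (C : ℝ) :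
    ((volume : Measure (Fin N → ℂ)).prod (complexGaussian (1 : Matrix (Fin N) (Fin N) ℂ)))
      {p | ∑ i, ‖p.1 i‖ ≤ C * ∑ i, ‖p.2 i‖} < ∞ := by
  -- Chosen so that `c ∑ ‖y i‖² ≤ (1/2) ∑ ‖z i‖²` on the set, by Cauchy–Schwarz; the `+ 1` keeps the
  -- denominator positive.
  set c : ℝ := 1 / (2 * (C ^ 2 * N + 1)) with hc
  have hc0 : 0 < c := by positivity
  have hmeas : MeasurableSet {p : (Fin N → ℂ) × (Fin N → ℂ) |
      ∑ i, ‖p.1 i‖ ≤ C * ∑ i, ‖p.2 i‖} := measurableSet_le (by fun_prop) (by fun_prop)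
  have hint : Integrable (fun p : (Fin N → ℂ) × (Fin N → ℂ) ↦
      (∏ i, Real.exp (-c * ‖p.1 i‖ ^ 2)) *
        ∏ i, (Real.exp (-(1 / 2) * ‖p.2 i‖ ^ 2) / Real.pi)) (volume.prod volume) := by
    refine Integrable.mul_prod (f := fun y : Fin N → ℂ ↦ ∏ i, Real.exp (-c * ‖y i‖ ^ 2))
      (g := fun z : Fin N → ℂ ↦ ∏ i, (Real.exp (-(1 / 2) * ‖z i‖ ^ 2) / Real.pi)) ?_ ?_
    · exact Integrable.fintype_prod (f := fun _ z ↦ Real.exp (-c * ‖z‖ ^ 2))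
        fun i ↦ integrable_exp_neg_mul_norm_sq hc0
    · exact Integrable.fintype_prod (f := fun _ z ↦ Real.exp (-(1 / 2) * ‖z‖ ^ 2) / Real.pi)
        fun i ↦ (integrable_exp_neg_mul_norm_sq (by norm_num)).div_const _
  unfold complexGaussian
  simp_rw [complexGaussian_one_density]
  rw [prod_withDensity_right (by fun_prop), withDensity_apply _ hmeas]
  refine lt_of_le_of_lt ?_ hint.lintegral_lt_top
  rw [← lintegral_indicator hmeas]
  refine lintegral_mono fun p ↦ ?_
  by_cases hp : p ∈ {p : (Fin N → ℂ) × (Fin N → ℂ) | ∑ i, ‖p.1 i‖ ≤ C * ∑ i, ‖p.2 i‖}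
  swap
  · rw [Set.indicator_of_notMem hp]
    exact zero_le
  rw [Set.indicator_of_mem hp]
  refine ENNReal.ofReal_le_ofReal ?_
  simp only [Finset.prod_div_distrib, ← Real.exp_sum]
  rw [← mul_div_assoc, ← Real.exp_add]
  refine div_le_div_of_nonneg_right (Real.exp_le_exp.2 ?_) (by positivity)
  rw [← Finset.mul_sum, ← Finset.mul_sum, Finset.sum_neg_distrib]
  have h1 : ∑ i, ‖p.1 i‖ ^ 2 ≤ (∑ i, ‖p.1 i‖) ^ 2 :=
    Finset.sum_sq_le_sq_sum_of_nonneg fun i _ ↦ norm_nonneg _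
  have h2 : (∑ i, ‖p.2 i‖) ^ 2 ≤ N * ∑ i, ‖p.2 i‖ ^ 2 := by
    simpa using sq_sum_le_card_mul_sum_sq (s := Finset.univ) (f := fun i ↦ ‖p.2 i‖)
  have h3 : (∑ i, ‖p.1 i‖) ^ 2 ≤ (C * ∑ i, ‖p.2 i‖) ^ 2 :=
    pow_le_pow_left₀ (by positivity) hp 2
  have h4 : ∑ i, ‖p.1 i‖ ^ 2 ≤ (C ^ 2 * N + 1) * ∑ i, ‖p.2 i‖ ^ 2 := by
    have : 0 ≤ ∑ i, ‖p.2 i‖ ^ 2 := by positivity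
    nlinarith [sq_nonneg C]
  have h5 : c * ∑ i, ‖p.1 i‖ ^ 2 ≤ 1 / 2 * ∑ i, ‖p.2 i‖ ^ 2 := by
    calc c * ∑ i, ‖p.1 i‖ ^ 2 ≤ c * ((C ^ 2 * N + 1) * ∑ i, ‖p.2 i‖ ^ 2) := by gcongr
      _ = _ := by
        rw [hc]
        field_simp
  linarith

/-! ### Change of variables and the high-SNR limit for one symbol -/

theorem measurable_amrcEstimate {N : ℕ} {Qadc Qdet : ℂ → ℂ} (hQadc : Measurable Qadc)
    (hQdet : Measurable Qdet) (K : Matrix (Fin N) (Fin N) ℂ) (ρ : ℝ) :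
    Measurable fun q : ℂ × (Fin N → ℂ) × (Fin N → ℂ) ↦
      amrcEstimate Qadc Qdet ρ K q.1 q.2.1 q.2.2 := by
  refine hQdet.comp ?_
  simp only [dotProduct, receivedSignal, amrcCombiner, Matrix.mulVec, Pi.star_apply]
  fun_prop

theorem Matrix.PosDef.det_re_pos {N : ℕ} {K : Matrix (Fin N) (Fin N) ℂ} (hK : K.PosDef) :
    0 < K.det.re := (Complex.lt_def.1 hK.det_pos).1

/-- The density of `complexGaussian K`. -/
noncomputable def complexGaussianDensity {N : ℕ} (K : Matrix (Fin N) (Fin N) ℂ) (u : Fin N → ℂ) :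
    ℝ≥0∞ :=
  ENNReal.ofReal (Real.exp (-(star u ⬝ᵥ (K⁻¹ *ᵥ u)).re) / (Real.pi ^ N * K.det.re))

theorem continuous_complexGaussianDensity {N : ℕ} (K : Matrix (Fin N) (Fin N) ℂ) :
    Continuous (complexGaussianDensity K) := by
  unfold complexGaussianDensity
  refine ENNReal.continuous_ofReal.comp ?_
  simp only [dotProduct, Matrix.mulVec, Pi.star_apply]
  fun_prop

theorem complexGaussianDensity_zero {N : ℕ} (K : Matrix (Fin N) (Fin N) ℂ) :
    complexGaussianDensity K 0 = ENNReal.ofReal (1 / (Real.pi ^ N * K.det.re)) := by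
  simp [complexGaussianDensity]

theorem complexGaussianDensity_le {N : ℕ} {K : Matrix (Fin N) (Fin N) ℂ} (hK : K.PosDef)
    (u : Fin N → ℂ) : complexGaussianDensity K u ≤ complexGaussianDensity K 0 := by
  rw [complexGaussianDensity_zero]
  refine ENNReal.ofReal_le_ofReal ?_
  have := hK.det_re_pos
  refine div_le_div_of_nonneg_right (Real.exp_le_one_iff.2 (neg_nonpos.2 ?_)) (by positivity)
  exact (Complex.le_def.1 (hK.inv.posSemidef.dotProduct_mulVec_nonneg u)).1

theorem tendsto_channelOf {N : ℕ} (s : ℂ) (y z : Fin N → ℂ) :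
    Tendsto (fun ρ ↦ channelOf ρ s y z) atTop (𝓝 0) := by
  have := (tendsto_inv_atTop_zero.comp Real.tendsto_sqrt_atTop).smul_const
    (fun i ↦ conj s * (y i - z i))
  rwa [zero_smul] at this

theorem measurable_channelOf {N : ℕ} (ρ : ℝ) (s : ℂ) :
    Measurable fun p : (Fin N → ℂ) × (Fin N → ℂ) ↦ channelOf ρ s p.1 p.2 := by
  unfold channelOf
  fun_prop

/-- Translation and rotation preserve volume; only the scaling by `1 / √ρ` in real dimension `2N`
contributes. -/
theorem map_channelOf {N : ℕ} {ρ : ℝ} (hρ : 0 < ρ) {s : ℂ} (hs : ‖s‖ = 1) (z : Fin N → ℂ) :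
    (volume : Measure (Fin N → ℂ)).map (fun y ↦ channelOf ρ s y z) =
      ENNReal.ofReal (ρ ^ N) • volume := by
  have h1 : MeasurePreserving (fun y : Fin N → ℂ ↦ y - z) volume volume :=
    measurePreserving_sub_right volume z
  have h2 : MeasurePreserving (fun (u : Fin N → ℂ) i ↦ conj s * u i) volume volume :=
    volume_preserving_pi fun _ ↦
      measurePreserving_mul_of_norm_eq_one (by rw [RCLike.norm_conj, hs])
  have h3 : (fun y ↦ channelOf ρ s y z) = (fun u : Fin N → ℂ ↦ (Real.sqrt ρ)⁻¹ • u) ∘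
      ((fun (u : Fin N → ℂ) i ↦ conj s * u i) ∘ fun y ↦ y - z) := rfl
  have h4 : (Real.sqrt ρ)⁻¹ ≠ 0 := inv_ne_zero (Real.sqrt_pos.2 hρ).ne'
  rw [h3, ← Measure.map_map (measurable_const_smul _) (h2.measurable.comp h1.measurable),
    (h2.comp h1).map_eq, Measure.map_addHaar_smul _ h4]
  congr 2
  have h5 : Module.finrank ℝ (Fin N → ℂ) = 2 * N := by
    rw [Module.finrank_pi_fintype]
    simp [Complex.finrank_real_complex, mul_comm]
  rw [h5, inv_pow, inv_inv, pow_mul, Real.sq_sqrt hρ.le, abs_of_pos (by positivity)]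

/-- The pairs `(y, z)` for which the receiver errs when `s` is sent. -/
def symbolErrorSet {N : ℕ} (Qadc Qdet : ℂ → ℂ) (K : Matrix (Fin N) (Fin N) ℂ) (ρ : ℝ) (s : ℂ) :
    Set ((Fin N → ℂ) × (Fin N → ℂ)) :=
  {p | amrcEstimate Qadc Qdet ρ K s (channelOf ρ s p.1 p.2) p.2 ≠ s}

theorem measurableSet_symbolErrorSet {N : ℕ} {Qadc Qdet : ℂ → ℂ} (hQadc : Measurable Qadc)
    (hQdet : Measurable Qdet) (K : Matrix (Fin N) (Fin N) ℂ) (ρ : ℝ) (s : ℂ) :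
    MeasurableSet (symbolErrorSet Qadc Qdet K ρ s) := by
  have h1 := measurable_channelOf (N := N) ρ s
  have h2 : Measurable fun p : (Fin N → ℂ) × (Fin N → ℂ) ↦ (s, channelOf ρ s p.1 p.2, p.2) :=
    measurable_const.prodMk (h1.prodMk measurable_snd)
  have h3 := (measurable_amrcEstimate hQadc hQdet K ρ).comp h2
  simp only [Function.comp_def] at h3
  exact (measurableSet_eq_fun h3 measurable_const).compl

theorem ofReal_pow_mul_measure_error {N : ℕ} {Qadc Qdet : ℂ → ℂ} (hQadc : Measurable Qadc)
    (hQdet : Measurable Qdet) (K : Matrix (Fin N) (Fin N) ℂ) {ρ : ℝ} (hρ : 0 < ρ) {s : ℂ}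
    (hs : ‖s‖ = 1) :
    ENNReal.ofReal (ρ ^ N) * ((complexGaussian K).prod (complexGaussian 1))
        {q : (Fin N → ℂ) × (Fin N → ℂ) | amrcEstimate Qadc Qdet ρ K s q.1 q.2 ≠ s} =
      ∫⁻ p, (symbolErrorSet Qadc Qdet K ρ s).indicator
        (fun p ↦ complexGaussianDensity K (channelOf ρ s p.1 p.2)) p
          ∂(volume.prod (complexGaussian (1 : Matrix (Fin N) (Fin N) ℂ))) := by
  set S := {q : (Fin N → ℂ) × (Fin N → ℂ) | amrcEstimate Qadc Qdet ρ K s q.1 q.2 ≠ s} with hS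
  have hSm : MeasurableSet S := by
    have h2 : Measurable fun q : (Fin N → ℂ) × (Fin N → ℂ) ↦ (s, q) :=
      measurable_const.prodMk measurable_id
    have h3 := (measurable_amrcEstimate hQadc hQdet K ρ).comp h2
    simp only [Function.comp_def] at h3
    exact (measurableSet_eq_fun h3 measurable_const).compl
  have hdm := (continuous_complexGaussianDensity K).measurable
  have hfm : Measurable (S.indicator fun q ↦ complexGaussianDensity K q.1) :=
    (hdm.comp measurable_fst).indicator hSm
  have hgm : Measurable ((symbolErrorSet Qadc Qdet K ρ s).indicator
      fun p ↦ complexGaussianDensity K (channelOf ρ s p.1 p.2)) :=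
    (hdm.comp (measurable_channelOf ρ s)).indicator
      (measurableSet_symbolErrorSet hQadc hQdet K ρ s)
  have h1 : complexGaussian K = volume.withDensity (complexGaussianDensity K) := rfl
  rw [h1, prod_withDensity_left hdm, withDensity_apply _ hSm, ← lintegral_indicator hSm,
    lintegral_prod_symm _ hfm.aemeasurable, lintegral_prod_symm _ hgm.aemeasurable,
    ← lintegral_const_mul _ hfm.lintegral_prod_left']
  refine lintegral_congr fun z ↦ ?_
  have hfz : Measurable fun h ↦ (S.indicator fun q ↦ complexGaussianDensity K q.1) (h, z) :=
    hfm.comp measurable_prodMk_right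
  have hcz : Measurable fun y : Fin N → ℂ ↦ channelOf ρ s y z :=
    (measurable_channelOf ρ s).comp measurable_prodMk_right
  rw [← smul_eq_mul, ← lintegral_smul_measure, ← map_channelOf hρ hs z, lintegral_map hfz hcz]
  refine lintegral_congr fun y ↦ ?_
  have hiff : (y, z) ∈ symbolErrorSet Qadc Qdet K ρ s ↔ (channelOf ρ s y z, z) ∈ S := Iff.rfl
  by_cases hy : (channelOf ρ s y z, z) ∈ S
  · rw [Set.indicator_of_mem hy, Set.indicator_of_mem (hiff.2 hy)]
  · rw [Set.indicator_of_notMem hy, Set.indicator_of_notMem (fun h ↦ hy (hiff.1 h))]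

/-- Dominated convergence, with bound the peak density on the set where the signal is controlled by
the noise. Off the limiting boundary lines the strict inequalities persist for large `ρ`. -/
theorem tendsto_lintegral_symbolError {N M n : ℕ} (hN : 1 ≤ N) (hM : 2 ≤ M) (hMn : M < 2 ^ n)
    {Qadc Qdet : ℂ → ℂ} (hQadc : IsPhaseQuantizer (2 ^ n) Qadc) (hQdet : IsPhaseQuantizer M Qdet)
    {K : Matrix (Fin N) (Fin N) ℂ} (hK : K.PosDef) {s : ℂ} (hs : s ∈ pskConstellation M) :
    Tendsto (fun ρ ↦ ∫⁻ p, (symbolErrorSet Qadc Qdet K ρ s).indicator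
        (fun p ↦ complexGaussianDensity K (channelOf ρ s p.1 p.2)) p
          ∂(volume.prod (complexGaussian (1 : Matrix (Fin N) (Fin N) ℂ)))) atTop
      (𝓝 (ENNReal.ofReal (1 / (Real.pi ^ N * K.det.re)) *
        (volume.prod (complexGaussian 1)) (limitErrorSet N Qadc (Real.pi / M)))) := by
  have hM' : (2 : ℝ) ≤ M := by exact_mod_cast hM
  have hMn' : (M : ℝ) < (2 ^ n : ℕ) := by exact_mod_cast hMn
  have hLb : Real.pi / (2 ^ n : ℕ) < Real.pi / M := by
    have := Real.pi_pos
    gcongr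
  have hb : Real.pi / M ≤ Real.pi / 2 := by
    have := Real.pi_pos
    gcongr
  set b := Real.pi / M with hbdef
  set c := complexGaussianDensity K 0 with hc
  rw [← complexGaussianDensity_zero, ← hc, ← lintegral_indicator_const
    (measurableSet_limitErrorSet N hQadc.measurable b)]
  obtain ⟨C, hC, hev⟩ := exists_eventually_derotatedStatistic_pos hQadc (by omega) hLb hb hK
  have hDm : MeasurableSet {p : (Fin N → ℂ) × (Fin N → ℂ) |
      ∑ i, ‖p.1 i‖ ≤ C * ∑ i, ‖p.2 i‖} := measurableSet_le (by fun_prop) (by fun_prop)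
  refine tendsto_lintegral_filter_of_dominated_convergence
    ({p : (Fin N → ℂ) × (Fin N → ℂ) | ∑ i, ‖p.1 i‖ ≤ C * ∑ i, ‖p.2 i‖}.indicator fun _ ↦ c)
    (Eventually.of_forall fun ρ ↦ ?_) ?_ ?_ ?_
  · exact ((continuous_complexGaussianDensity K).measurable.comp
      (measurable_channelOf ρ s)).indicator
        (measurableSet_symbolErrorSet hQadc.measurable hQdet.measurable K ρ s)
  · filter_upwards [hev, eventually_gt_atTop 0] with ρ hρ hρ0
    refine ae_of_all _ fun p ↦ ?_
    by_cases hp : p ∈ symbolErrorSet Qadc Qdet K ρ s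
    · rw [Set.indicator_of_mem hp, Set.indicator_of_mem]
      · exact complexGaussianDensity_le hK _
      · by_contra hlt
        exact hp (amrcEstimate_eq_of_pos hM hQdet hρ0 hs (hρ p.1 p.2 (not_le.1 hlt)))
    · rw [Set.indicator_of_notMem hp]
      exact zero_le
  · rw [lintegral_indicator_const hDm]
    exact ENNReal.mul_ne_top ENNReal.ofReal_ne_top (measure_norm_le_lt_top C).ne
  -- For fixed `y`, the limit lying on an edge line is one nontrivial real affine equation in `z`,
  -- hence a null event.
  · have hne : ∀ σ, ∀ᵐ p : (Fin N → ℂ) × (Fin N → ℂ) ∂(volume.prod (complexGaussian (1 : Matrix (Fin N) (Fin N) ℂ))),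
        (edgeNormal b σ * ∑ i, conj (Qadc (p.1 i)) * (p.1 i - p.2 i)).im ≠ 0 := by
      intro σ
      have hQm := hQadc.measurable
      have hms : MeasurableSet {p : (Fin N → ℂ) × (Fin N → ℂ) |
          (edgeNormal b σ * ∑ i, conj (Qadc (p.1 i)) * (p.1 i - p.2 i)).im = 0} :=
        measurableSet_eq_fun (by fun_prop) measurable_const
      refine measure_eq_zero_iff_ae_notMem.1 ((Measure.measure_prod_null hms).2 (ae_of_all _ ?_))
      intro y
      have hac : complexGaussian (1 : Matrix (Fin N) (Fin N) ℂ) ≪ volume :=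
        withDensity_absolutelyContinuous _ _
      refine hac ?_
      have h0 (i : Fin N) : edgeNormal b σ * conj (Qadc (y i)) ≠ 0 := by
        rw [← norm_ne_zero_iff, norm_mul, norm_edgeNormal, RCLike.norm_conj, hQadc.norm_eq]
        simp
      convert volume_im_sum_eq_zero (fun i ↦ edgeNormal b σ * conj (Qadc (y i))) ⟨0, hN⟩ (h0 _)
        (∑ i, (edgeNormal b σ * conj (Qadc (y i)) * y i).im) using 2
      ext z
      simp only [Set.mem_preimage, Set.mem_ofPred_eq, Finset.mul_sum, Complex.im_sum, mul_sub,
        Complex.sub_im, Finset.sum_sub_distrib, mul_assoc]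
      rw [sub_eq_zero, eq_comm]
    filter_upwards [hne true, hne false] with p ht hf
    have hp : ∀ σ, (edgeNormal b σ * ∑ i, conj (Qadc (p.1 i)) * (p.1 i - p.2 i)).im ≠ 0 := by
      intro σ
      cases σ <;> assumption
    have hlim (σ : Bool) : Tendsto (fun ρ ↦ (edgeNormal b σ *
        derotatedStatistic Qadc K ρ p.1 p.2).im) atTop
        (𝓝 (edgeNormal b σ * ∑ i, conj (Qadc (p.1 i)) * (p.1 i - p.2 i)).im) :=
      (Complex.continuous_im.tendsto _).comp
        ((tendsto_derotatedStatistic hK Qadc p.1 p.2).const_mul _)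
    have hmem (σ : Bool) : p ∈ edgeErrorSet N Qadc b σ ↔
        (edgeNormal b σ * ∑ i, conj (Qadc (p.1 i)) * (p.1 i - p.2 i)).im < 0 := by
      simp only [edgeErrorSet, Set.mem_ofPred_eq, Finset.mul_sum, Complex.im_sum]
    by_cases hE : p ∈ limitErrorSet N Qadc b
    · rw [Set.indicator_of_mem hE]
      obtain ⟨σ, hσ⟩ := hE
      have h1 := ((continuous_complexGaussianDensity K).tendsto 0).comp
        (tendsto_channelOf s p.1 p.2)
      refine h1.congr' ?_
      filter_upwards [(hlim σ).eventually_lt_const ((hmem σ).1 hσ), eventually_gt_atTop 0]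
        with ρ hρ hρ0
      rw [Set.indicator_of_mem]
      · rfl
      · exact amrcEstimate_ne_of_neg hM hQdet hρ0 hs hρ
    · rw [Set.indicator_of_notMem hE]
      have h2 (σ : Bool) : 0 < (edgeNormal b σ *
          ∑ i, conj (Qadc (p.1 i)) * (p.1 i - p.2 i)).im := by
        refine lt_of_le_of_ne ?_ (hp σ).symm
        by_contra! h
        exact hE ⟨σ, (hmem σ).2 h⟩
      refine tendsto_const_nhds.congr' ?_
      filter_upwards [eventually_all.2 fun σ ↦ (hlim σ).eventually_const_lt (h2 σ),
        eventually_gt_atTop 0] with ρ hρ hρ0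
      rw [Set.indicator_of_notMem]
      exact fun h ↦ h (amrcEstimate_eq_of_pos hM hQdet hρ0 hs hρ)

/-! ### Existence of quantizers and averaging over symbols -/

theorem exists_measurable_nearest {S : Finset ℂ} (hS : S.Nonempty) :
    ∃ Q : ℂ → ℂ, Measurable Q ∧ (∀ x, Q x ∈ S) ∧ ∀ x, ∀ s ∈ S, ‖Q x - x‖ ≤ ‖s - x‖ := by
  classical
  induction hS using Finset.Nonempty.cons_induction with
  | singleton a => exact ⟨fun _ ↦ a, measurable_const, by simp, by simp⟩
  | cons a S ha hS ih =>
    obtain ⟨Q, hQ, hmem, hmin⟩ := ih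
    refine ⟨fun x ↦ if ‖a - x‖ ≤ ‖Q x - x‖ then a else Q x,
      Measurable.ite (measurableSet_le (by fun_prop) (by fun_prop)) measurable_const hQ,
      fun x ↦ ?_, fun x s hs ↦ ?_⟩ <;> beta_reduce
    · split_ifs
      · exact Finset.mem_cons_self _ _
      · exact Finset.mem_cons_of_mem (hmem x)
    · rcases Finset.mem_cons.1 hs with rfl | hs
      · split_ifs with h
        · exact le_rfl
        · exact (not_le.1 h).le
      · split_ifs with h
        · exact h.trans (hmin x s hs)
        · exact hmin x s hs

theorem exists_isPhaseQuantizer {L : ℕ} (hL : 0 < L) : ∃ Q, IsPhaseQuantizer L Q := by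
  obtain ⟨Q, hQ, hmem, hmin⟩ := exists_measurable_nearest
    ((pskConstellation_finite L).toFinset_nonempty.2 (pskConstellation_nonempty hL))
  exact ⟨Q, hQ, fun x ↦ (pskConstellation_finite L).mem_toFinset.1 (hmem x),
    fun x s hs ↦ hmin x s ((pskConstellation_finite L).mem_toFinset.2 hs)⟩

theorem amrcSEP_eq {Ω : Type*} [MeasurableSpace Ω] {P : Measure Ω} [IsProbabilityMeasure P]
    {N M : ℕ} {Qadc Qdet : ℂ → ℂ} (hQadc : Measurable Qadc)
    (hQdet : Measurable Qdet) (K : Matrix (Fin N) (Fin N) ℂ)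
    {s : Ω → ℂ} {h z : Ω → Fin N → ℂ}
    (hs : HasLaw s (uniformOn (pskConstellation M)) P) (hh : HasLaw h (complexGaussian K) P)
    (hz : HasLaw z (complexGaussian 1) P) (hhz : IndepFun h z P)
    (hshz : IndepFun s (fun ω ↦ (h ω, z ω)) P) (ρ : ℝ) :
    amrcSEP P Qadc Qdet K s h z ρ =
      (∫⁻ s, ((complexGaussian K).prod (complexGaussian 1))
        {q : (Fin N → ℂ) × (Fin N → ℂ) | amrcEstimate Qadc Qdet ρ K s q.1 q.2 ≠ s}
          ∂(uniformOn (pskConstellation M))).toReal := by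
  have hT : MeasurableSet {q : ℂ × (Fin N → ℂ) × (Fin N → ℂ) |
      amrcEstimate Qadc Qdet ρ K q.1 q.2.1 q.2.2 ≠ q.1} :=
    (measurableSet_eq_fun (measurable_amrcEstimate hQadc hQdet K ρ) measurable_fst).compl
  have hhzm : AEMeasurable (fun ω ↦ (h ω, z ω)) P := hh.aemeasurable.prodMk hz.aemeasurable
  have h1 : P.map (fun ω ↦ (s ω, (h ω, z ω))) = (uniformOn (pskConstellation M)).prod
      ((complexGaussian K).prod (complexGaussian 1)) := by
    rw [(indepFun_iff_map_prod_eq_prod_map_map hs.aemeasurable hhzm).1 hshz,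
      (indepFun_iff_map_prod_eq_prod_map_map hh.aemeasurable hz.aemeasurable).1 hhz,
      hs.map_eq, hh.map_eq, hz.map_eq]
  have : SFinite ((complexGaussian K).prod (complexGaussian (1 : Matrix (Fin N) (Fin N) ℂ))) := by
    unfold complexGaussian
    infer_instance
  have h2 := Measure.map_apply_of_aemeasurable (hs.aemeasurable.prodMk hhzm) hT
  rw [h1, Measure.prod_apply hT] at h2
  exact congrArg ENNReal.toReal h2.symm

theorem tendsto_pow_mul_amrcSEP {Ω : Type*} [MeasurableSpace Ω] {P : Measure Ω}
    [IsProbabilityMeasure P] {N M n : ℕ} (hN : 1 ≤ N) (hM : 2 ≤ M) (hMn : M < 2 ^ n)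
    {Qadc Qdet : ℂ → ℂ} (hQadc : IsPhaseQuantizer (2 ^ n) Qadc) (hQdet : IsPhaseQuantizer M Qdet)
    {K : Matrix (Fin N) (Fin N) ℂ} (hK : K.PosDef)
    {s : Ω → ℂ} {h z : Ω → Fin N → ℂ}
    (hs : HasLaw s (uniformOn (pskConstellation M)) P) (hh : HasLaw h (complexGaussian K) P)
    (hz : HasLaw z (complexGaussian 1) P) (hhz : IndepFun h z P)
    (hshz : IndepFun s (fun ω ↦ (h ω, z ω)) P)
    (hfin : ((volume : Measure (Fin N → ℂ)).prod (complexGaussian 1))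
      (limitErrorSet N Qadc (Real.pi / M)) ≠ ∞) :
    Tendsto (fun ρ ↦ ρ ^ N * amrcSEP P Qadc Qdet K s h z ρ) atTop
      (𝓝 (((volume : Measure (Fin N → ℂ)).prod (complexGaussian 1)).real
        (limitErrorSet N Qadc (Real.pi / M)) / (Real.pi ^ N * K.det.re))) := by
  set S := pskConstellation M with hS
  set E := limitErrorSet N Qadc (Real.pi / M) with hE
  set l := ENNReal.ofReal (1 / (Real.pi ^ N * K.det.re)) *
    ((volume : Measure (Fin N → ℂ)).prod (complexGaussian 1)) E with hl
  have hlfin : l ≠ ∞ := ENNReal.mul_ne_top ENNReal.ofReal_ne_top hfin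
  have hSfin : S.Finite := pskConstellation_finite M
  have : IsProbabilityMeasure (uniformOn S) :=
    isProbabilityMeasure_uniformOn hSfin (pskConstellation_nonempty (by omega))
  set F : ℝ → ℂ → ℝ≥0∞ := fun ρ s ↦ ENNReal.ofReal (ρ ^ N) *
    ((complexGaussian K).prod (complexGaussian 1))
      {q : (Fin N → ℂ) × (Fin N → ℂ) | amrcEstimate Qadc Qdet ρ K s q.1 q.2 ≠ s} with hF
  have hmeas (ρ : ℝ) : Measurable fun s ↦ ((complexGaussian K).prod (complexGaussian 1))
      {q : (Fin N → ℂ) × (Fin N → ℂ) | amrcEstimate Qadc Qdet ρ K s q.1 q.2 ≠ s} := by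
    have hT : MeasurableSet {q : ℂ × (Fin N → ℂ) × (Fin N → ℂ) |
        amrcEstimate Qadc Qdet ρ K q.1 q.2.1 q.2.2 ≠ q.1} :=
      (measurableSet_eq_fun (measurable_amrcEstimate hQadc.measurable hQdet.measurable K ρ)
        measurable_fst).compl
    have : SFinite ((complexGaussian K).prod (complexGaussian (1 : Matrix (Fin N) (Fin N) ℂ))) := by
      unfold complexGaussian
      infer_instance
    exact measurable_measure_prodMk_left hT
  have hlimF : ∀ s ∈ S, Tendsto (fun ρ ↦ F ρ s) atTop (𝓝 l) := by
    intro s hs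
    refine (tendsto_lintegral_symbolError hN hM hMn hQadc hQdet hK hs).congr' ?_
    filter_upwards [eventually_gt_atTop 0] with ρ hρ
    exact (ofReal_pow_mul_measure_error hQadc.measurable hQdet.measurable K hρ
      (norm_of_mem_pskConstellation hs)).symm
  have hae : ∀ᵐ s ∂(uniformOn S), s ∈ S := ae_cond_mem hSfin.measurableSet
  have hlim : Tendsto (fun ρ ↦ ∫⁻ s, F ρ s ∂(uniformOn S)) atTop
      (𝓝 (∫⁻ _, l ∂(uniformOn S))) := by
    -- Every symbol has the same limit `l`, and there are finitely many symbols, so `l + 1`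
    -- eventually dominates all of them at once.
    refine tendsto_lintegral_filter_of_dominated_convergence (fun _ ↦ l + 1)
      (Eventually.of_forall fun ρ ↦ (hmeas ρ).const_mul _) ?_ (by simp [hlfin]) ?_
    · have : ∀ᶠ ρ in atTop, ∀ s ∈ S, F ρ s ≤ l + 1 := by
        rw [eventually_all_finite hSfin]
        exact fun s hs ↦ (hlimF s hs).eventually_le_const (ENNReal.lt_add_right hlfin one_ne_zero)
      filter_upwards [this] with ρ hρ
      filter_upwards [hae] with s hs using hρ s hs
    · filter_upwards [hae] with s hs using hlimF s hs
  rw [lintegral_const, measure_univ, mul_one] at hlim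
  have h1 := (ENNReal.tendsto_toReal hlfin).comp hlim
  have h2 : l.toReal = ((volume : Measure (Fin N → ℂ)).prod (complexGaussian 1)).real E /
      (Real.pi ^ N * K.det.re) := by
    have := hK.det_re_pos
    rw [hl, ENNReal.toReal_mul, ENNReal.toReal_ofReal (by positivity), Measure.real]
    ring
  rw [h2] at h1
  refine h1.congr' ?_
  filter_upwards [eventually_gt_atTop 0] with ρ hρ
  simp only [Function.comp_def, hF]
  rw [lintegral_const_mul _ (hmeas ρ), ENNReal.toReal_mul, ENNReal.toReal_ofReal (by positivity),
    amrcSEP_eq hQadc.measurable hQdet.measurable K hs hh hz hhz hshz]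

/-! ### The factor `k` and the conclusion -/

theorem cot_sub_cot_pos {a b : ℝ} (ha : 0 < a) (hab : a < b) (hb : b ≤ Real.pi / 2) :
    0 < Real.cot (b - a) - Real.cot (b + a) := by
  have h1 : 0 < Real.sin (b - a) := Real.sin_pos_of_pos_of_lt_pi (by linarith) (by linarith)
  have h2 : 0 < Real.sin (b + a) := Real.sin_pos_of_pos_of_lt_pi (by linarith) (by linarith)
  have h3 : 0 < Real.sin (2 * a) := Real.sin_pos_of_pos_of_lt_pi (by linarith) (by linarith)
  have h4 : Real.sin (2 * a) =
      Real.cos (b - a) * Real.sin (b + a) - Real.sin (b - a) * Real.cos (b + a) := by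
    rw [show 2 * a = (b + a) - (b - a) by ring, Real.sin_sub]
    ring
  rw [Real.cot_eq_cos_div_sin, Real.cot_eq_cos_div_sin, div_sub_div _ _ h1.ne' h2.ne', ← h4]
  positivity

theorem edgeErrorValue_pos {N n : ℕ} (hN : 1 ≤ N) {D : ℝ} (hD : 0 < D) :
    0 < edgeErrorValue N n D := by
  have hN0 : (0 : ℝ) < N := by exact_mod_cast hN
  have : 0 < Real.Gamma (N + 1 / 2 : ℝ) := Real.Gamma_pos_of_pos (by positivity)
  have := Real.pi_pos
  unfold edgeErrorValue
  positivity

/-- The union of two sets of equal measure has between one and two times that measure; the exact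
ratio depends on their overlap. -/
theorem measureReal_limitErrorSet_mem {N n : ℕ} (hN : 1 ≤ N) {Q : ℂ → ℂ} (hn : 3 ≤ 2 ^ n)
    (hQ : IsPhaseQuantizer (2 ^ n) Q) {b : ℝ} (hb' : Real.pi / 2 ^ n < b) (hb : b ≤ Real.pi / 2) :
    ((volume : Measure (Fin N → ℂ)).prod (complexGaussian 1)) (limitErrorSet N Q b) ≠ ∞ ∧
    ((volume : Measure (Fin N → ℂ)).prod (complexGaussian 1)).real (limitErrorSet N Q b) /
      edgeErrorValue N n (Real.cot (b - Real.pi / 2 ^ n) - Real.cot (b + Real.pi / 2 ^ n)) ∈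
        Set.Icc (1 : ℝ) 2 := by
  have hD := cot_sub_cot_pos (a := Real.pi / 2 ^ n) (by positivity) hb' hb
  have h1 := measure_edgeErrorSet hN hn hQ hb' hb hD.le
  set D := Real.cot (b - Real.pi / 2 ^ n) - Real.cot (b + Real.pi / 2 ^ n)
  have hA := edgeErrorValue_pos (n := n) hN hD
  set A := edgeErrorValue N n D
  set μ := (volume : Measure (Fin N → ℂ)).prod (complexGaussian (1 : Matrix (Fin N) (Fin N) ℂ))
  have hle : μ (limitErrorSet N Q b) ≤ ENNReal.ofReal (2 * A) := by
    have e : limitErrorSet N Q b = edgeErrorSet N Q b true ∪ edgeErrorSet N Q b false := by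
      ext p
      simp [limitErrorSet, or_comm]
    rw [e, two_mul, ENNReal.ofReal_add hA.le hA.le]
    exact (measure_union_le _ _).trans_eq (by rw [h1, h1])
  have hge : ENNReal.ofReal A ≤ μ (limitErrorSet N Q b) := by
    rw [← h1 true]
    exact measure_mono fun p hp ↦ ⟨true, hp⟩
  have hfin : μ (limitErrorSet N Q b) ≠ ∞ := ne_top_of_le_ne_top ENNReal.ofReal_ne_top hle
  refine ⟨hfin, ?_, ?_⟩
  · rw [one_le_div hA]
    exact (ENNReal.ofReal_le_iff_le_toReal hfin).1 hge
  · rw [div_le_iff₀ hA]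
    exact ENNReal.toReal_le_of_le_ofReal (by positivity) hle

theorem hasDiversityAndCodingGain_of_tendsto {N : ℕ} (hN : 1 ≤ N) {p : ℝ → ℝ} {T : ℝ} (hT : 0 < T)
    (h : Tendsto (fun ρ ↦ ρ ^ N * p ρ) atTop (𝓝 T)) :
    HasDiversityAndCodingGain p N (T ^ (-1 / (N : ℝ))) := by
  have hN0 : (0 : ℝ) < N := by exact_mod_cast hN
  refine ⟨hN0, Real.rpow_pos_of_pos hT _, ?_⟩
  have e (ρ : ℝ) (hρ : 0 < ρ) : (T ^ (-1 / (N : ℝ)) * ρ) ^ (-(N : ℝ)) = T / ρ ^ N := by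
    rw [Real.mul_rpow (Real.rpow_nonneg hT.le _) hρ.le, ← Real.rpow_mul hT.le,
      show -1 / (N : ℝ) * -(N : ℝ) = 1 by field_simp, Real.rpow_one, Real.rpow_neg hρ.le,
      Real.rpow_natCast, div_eq_mul_inv]
  refine isEquivalent_of_tendsto_one ?_
  have h2 := h.div_const T
  rw [div_self hT.ne'] at h2
  refine h2.congr' ?_
  filter_upwards [eventually_gt_atTop 0] with ρ hρ
  rw [Pi.div_apply, e ρ hρ]
  field_simp

theorem codingGain_eq {N M n : ℕ} {K : Matrix (Fin N) (Fin N) ℂ} (k : ℝ) :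
    codingGain N M n K k = (k * edgeErrorValue N n
      (Real.cot (Real.pi / M - Real.pi / 2 ^ n) - Real.cot (Real.pi / M + Real.pi / 2 ^ n)) /
        (Real.pi ^ N * K.det.re)) ^ (-1 / (N : ℝ)) := by
  have h1 : (2 : ℝ) ^ ((n : ℝ) * N - 1) = (2 ^ n) ^ N / 2 := by
    rw [Real.rpow_sub two_pos, Real.rpow_one, ← pow_mul, ← Nat.cast_mul, Real.rpow_natCast]
  have h2 : Real.pi ^ ((N : ℝ) + 1 / 2) = Real.pi ^ N * Real.sqrt Real.pi := by
    rw [Real.rpow_add Real.pi_pos, Real.rpow_natCast, Real.sqrt_eq_rpow]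
  rw [codingGain, edgeErrorValue, h1, h2, mul_pow]
  congr 1
  ring

theorem proposition3 (N M n : ℕ) (hN : 1 ≤ N) (hM : 2 ≤ M) (hMn : M < 2 ^ n) :
    ∃ k ∈ Set.Icc (1 : ℝ) 2,
      ∀ (K : Matrix (Fin N) (Fin N) ℂ), K.PosDef →
      ∀ (Qadc Qdet : ℂ → ℂ), IsPhaseQuantizer (2 ^ n) Qadc → IsPhaseQuantizer M Qdet →
      ∀ (Ω : Type*) [MeasurableSpace Ω] (P : Measure Ω) [IsProbabilityMeasure P]
        (s : Ω → ℂ) (h z : Ω → Fin N → ℂ),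
        HasLaw s (uniformOn (pskConstellation M)) P →
        HasLaw h (complexGaussian K) P →
        HasLaw z (complexGaussian 1) P →
        IndepFun h z P →
        IndepFun s (fun ω => (h ω, z ω)) P →
        HasDiversityAndCodingGain (amrcSEP P Qadc Qdet K s h z) N (codingGain N M n K k) := by
  -- The factor `k` must be fixed before any quantizer is given, so it is defined through a
  -- reference quantizer; `hQQ` later transfers it to `Qadc`.
  obtain ⟨Q, hQ⟩ := exists_isPhaseQuantizer (L := 2 ^ n) (by positivity)
  have hn : 3 ≤ 2 ^ n := by omega
  have hpi := Real.pi_pos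
  have hM' : (2 : ℝ) ≤ M := by exact_mod_cast hM
  have hMn' : (M : ℝ) < 2 ^ n := by exact_mod_cast hMn
  have hLb : Real.pi / 2 ^ n < Real.pi / M := by gcongr
  have hb : Real.pi / M ≤ Real.pi / 2 := by gcongr
  have hA := edgeErrorValue_pos (n := n) hN (cot_sub_cot_pos (by positivity) hLb hb)
  obtain ⟨hfin, hk⟩ := measureReal_limitErrorSet_mem hN hn hQ hLb hb
  refine ⟨_, hk, fun K hK Qadc Qdet hQadc hQdet Ω _ P _ s h z hs hh hz hhz hshz ↦ ?_⟩
  have hQQ := measure_limitErrorSet_congr (N := N) hQadc hQ (by omega) (Real.pi / M)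
  have hlim := tendsto_pow_mul_amrcSEP hN hM hMn hQadc hQdet hK hs hh hz hhz hshz
    (by rwa [hQQ])
  rw [Measure.real, hQQ, ← Measure.real] at hlim
  rw [codingGain_eq, div_mul_cancel₀ _ hA.ne']
  refine hasDiversityAndCodingGain_of_tendsto hN ?_ hlim
  have h1 := (one_le_div hA).1 hk.1
  have := hK.det_re_pos
  have := hA.trans_le h1
  positivity
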